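/- **Proposition 4.2 (maximum principle for the first component).** Let $\mathbb T^2=\mathbb R^2/2\pi\mathbb Z^2$ and let $\nu>0$, $\lambda>0$, $T>0$. Write $(f,g)=\int_{\mathbb T^2}fg\,dx$. Let $\mathbf u=(u_1,u_2)$ be a real-valued strong solution on $[0,T]$, with initial value $\mathbf u(0)=\mathbf u^{in}=(u_1^{in},u_2^{in})\in L^2(\mathbb T^2)^2$, of the reduced Kuramoto–Sivashinsky system $$\partial_t u_1+(\mathbf u\cdot\nabla)u_1=\nu\Delta u_1,\qquad \partial_t u_2+(\mathbf u\cdot\nabla)u_2=-\lambda\Delta u_2-\Delta^2u_2 \qquad\text{on }\mathbb T^2\times(0,T),$$ that is: $\mathbf u\in L^\infty([0,T];H^1(\mathbb T^2))$, $u_1\in L^2([0,T];H^2(\mathbb T^2))$, $u_2\in L^2([0,T];H^3(\mathbb T^2))$, $\mathbf u\in C([0,T];H^s(\mathbb T^2))$ for every $s\in[0,1)$, the distributional time derivative satisfies $\partial_t\mathbf u\in L^2([0,T];H^{-1}(\mathbb T^2))$, and for all $\phi_1,\phi_2\in C^\infty(\mathbb T^2)$ and almost every $t\in[0,T]$, $$(\partial_tu_1,\phi_1)+\nu(\nabla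 u_1,\nabla\phi_1)+(\mathbf u\cdot\nabla u_1,\phi_1)=0,$$ $$(\partial_tu_2,\phi_2)+(\Delta u_2,\Delta\phi_2)+(\mathbf u\cdot\nabla u_2,\phi_2)=\lambda(\nabla u_2,\nabla\phi_2).$$ Then $$\sup_{t\in[0,T]}\|u_1(t)\|_{L^\infty(\mathbb T^2)}\le\|u_1^{in}\|_{L^\infty(\mathbb T^2)},$$ where the right-hand side is $+\infty$ (and the claim is void) if $u_1^{in}\notin L^\infty(\mathbb T^2)$. -/

import Mathlib

open MeasureTheory Set Filter Topology
open scoped ENNReal ContDiff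

noncomputable section

namespace RKSE

instance factTwoPiPos : Fact (0 < 2 * Real.pi) := ⟨Real.two_pi_pos⟩

/-- The torus `𝕋² = ℝ² / 2πℤ²`, with its Lebesgue measure (of total mass `(2π)²`). -/
abbrev Torus : Type := Fin 2 → AddCircle (2 * Real.pi)

/-- The real Hilbert space `L²(𝕋²)`. -/
abbrev L2 : Type := Lp ℝ 2 (volume : Measure Torus)

/-- The space `C^∞(𝕋²)` of real functions on the torus whose periodic lift to `ℝ²` is smooth. -/
def testFunctions : Submodule ℝ (Torus → ℝ) where
  carrier := {φ | ContDiff ℝ ∞ fun y : Fin 2 → ℝ => φ fun i => (y i : AddCircle (2 * Real.pi))}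
  zero_mem' := (contDiff_const : ContDiff ℝ ∞ fun _ : Fin 2 → ℝ => (0 : ℝ))
  add_mem' := fun hf hg => by
    simp only [mem_ofPred_eq] at hf hg ⊢
    exact hf.add hg
  smul_mem' := fun c _ hf => by
    simp only [mem_ofPred_eq] at hf ⊢
    exact hf.const_smul c

/-- The classical partial derivative `∂ⱼφ` of a function on the torus. -/
def classicalPartial (j : Fin 2) (φ : Torus → ℝ) : Torus → ℝ := fun x =>
  deriv (fun h : ℝ => φ (x + Pi.single j (h : AddCircle (2 * Real.pi)))) 0

/-- The classical Laplacian `Δφ = ∂₁∂₁φ + ∂₂∂₂φ`. -/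
def classicalLaplacian (φ : Torus → ℝ) : Torus → ℝ := fun x =>
  ∑ j, classicalPartial j (classicalPartial j φ) x

/-- The pairing `(f, g) = ∫_{𝕋²} f g`. -/
def pairing (f g : Torus → ℝ) : ℝ := ∫ x, f x * g x

/-- `g ∈ L²` is the weak partial derivative `∂ⱼf` of `f ∈ L²`. -/
def IsWeakPartial (j : Fin 2) (f g : L2) : Prop :=
  ∀ φ ∈ testFunctions, pairing f (classicalPartial j φ) = -pairing g φ

open Classical in
/-- The weak partial derivative `∂ⱼf` in `L²` (it exists and is unique for `f ∈ H¹`; the value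
is `0` by convention when `f` has no weak partial derivative in `L²`). -/
def weakPartial (j : Fin 2) (f : L2) : L2 :=
  if h : ∃ g, IsWeakPartial j f g then h.choose else 0

/-- The weak Laplacian `Δf = ∂₁∂₁f + ∂₂∂₂f`, for `f ∈ H²`. -/
def weakLaplacian (f : L2) : L2 := ∑ j, weakPartial j (weakPartial j f)

/-- The Fourier coefficient `f̂(k) = (2π)⁻² ∫_{𝕋²} f(x) e^{-ik·x} dx`. -/
def fourierCoefficient (f : Torus → ℝ) (k : Fin 2 → ℤ) : ℂ :=
  ((2 * Real.pi : ℝ) ^ 2 : ℂ)⁻¹ * ∫ x, (f x : ℂ) * ∏ j, fourier (-(k j)) (x j)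

/-- The Euclidean length `|k|` of a frequency `k ∈ ℤ²`. -/
def freqNorm (k : Fin 2 → ℤ) : ℝ := Real.sqrt (∑ j, (k j : ℝ) ^ 2)

/-- The Sobolev norm `‖f‖_{H^s} = (∑ₖ (1 + |k|^s)² |f̂(k)|²)^{1/2} ∈ [0, ∞]`, for `s ≥ 0`;
an `L²` function belongs to `H^s(𝕋²)` iff it is finite. -/
def sobolevNorm (s : ℝ) (f : Torus → ℝ) : ℝ≥0∞ :=
  (∑' k : Fin 2 → ℤ,
    ENNReal.ofReal ((1 + freqNorm k ^ s) ^ 2 * ‖fourierCoefficient f k‖ ^ 2)) ^ (1 / 2 : ℝ)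

/-- Lebesgue measure on the time interval `[0, T]`. -/
abbrev timeMeasure (T : ℝ) : Measure ℝ := volume.restrict (Icc 0 T)

/-- `f ∈ L^p([0, T]; H^s(𝕋²))`, for `s ≥ 0`. -/
def MemLpSobolev (p : ℝ≥0∞) (s T : ℝ) (f : ℝ → L2) : Prop :=
  AEStronglyMeasurable f (timeMeasure T) ∧
    eLpNorm (fun t => sobolevNorm s (f t)) p (timeMeasure T) < ⊤

/-- `f ∈ C([0, T]; H^s(𝕋²))`, for `s ≥ 0`. -/
def MemCSobolev (s T : ℝ) (f : ℝ → L2) : Prop :=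
  ∀ t ∈ Icc 0 T, sobolevNorm s (f t) < ⊤ ∧
    Tendsto (fun r => sobolevNorm s (f r - f t : L2)) (𝓝[Icc 0 T] t) (𝓝 0)

/-- Linear functionals on `C^∞(𝕋²)`. -/
abbrev Functional : Type := testFunctions →ₗ[ℝ] ℝ

/-- The norm of `H^{-1}(𝕋²) = (H¹(𝕋²))'`: the least `C ∈ [0, ∞]` with `|g(φ)| ≤ C ‖φ‖_{H¹}` for
all smooth `φ`. As smooth functions are dense in `H¹`, the functionals for which it is finite
are exactly the elements of `H^{-1}`. -/
def dualNorm (g : Functional) : ℝ≥0∞ :=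
  ⨆ φ : testFunctions, ‖g φ‖ₑ / sobolevNorm 1 (φ : Torus → ℝ)

/-- `g ∈ L²([0, T]; H^{-1}(𝕋²))`; as `H^{-1}` is separable, measurability may be stated weakly. -/
def MemL2Dual (T : ℝ) (g : ℝ → Functional) : Prop :=
  (∀ φ, AEStronglyMeasurable (fun t => g t φ) (timeMeasure T)) ∧
    eLpNorm (fun t => dualNorm (g t)) 2 (timeMeasure T) < ⊤

/-- `∂ₜf = g` on `(0, T)` in the sense of distributions: for all `φ ∈ C^∞(𝕋²)` and all
`ψ ∈ C_c^∞((0, T))`, `∫₀ᵀ ψ'(t) (f(t), φ) dt = -∫₀ᵀ ψ(t) ⟨g(t), φ⟩ dt`. -/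
def IsWeakTimeDeriv (T : ℝ) (f : ℝ → L2) (g : ℝ → Functional) : Prop :=
  ∀ (φ : testFunctions) (ψ : ℝ → ℝ), ContDiff ℝ ∞ ψ → HasCompactSupport ψ →
    tsupport ψ ⊆ Ioo 0 T →
    ∫ t in Icc 0 T, deriv ψ t * pairing (f t) φ = -∫ t in Icc 0 T, ψ t * g t φ

/-- The pairing `(∇f, ∇φ)` of `f ∈ H¹` with a smooth `φ`. -/
def gradPairing (f : L2) (φ : Torus → ℝ) : ℝ :=
  ∑ j, pairing (weakPartial j f) (classicalPartial j φ)

/-- The transport term `((v·∇)f, φ) = ∫ (v₁ ∂₁f + v₂ ∂₂f) φ`. -/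
def transportPairing (v : Fin 2 → L2) (f : L2) (φ : Torus → ℝ) : ℝ :=
  pairing (fun x => ∑ j, v j x * weakPartial j f x) φ

/-- `u = (u₁, u₂)` (with `u₁ = u 0` and `u₂ = u 1`) is a strong solution over `[0, T]` of
`∂ₜu₁ + (u·∇)u₁ = νΔu₁`, `∂ₜu₂ + (u·∇)u₂ = -λΔu₂ - Δ²u₂` on `𝕋²` with `u(0) = uin`. -/
structure IsStrongSolution (ν lam T : ℝ) (uin : Fin 2 → L2) (u : Fin 2 → ℝ → L2) : Prop where
  initial : ∀ i, u i 0 = uin i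
  mem_Linfty_H1 : ∀ i, MemLpSobolev ⊤ 1 T (u i)
  mem_L2_H2 : MemLpSobolev 2 2 T (u 0)
  mem_L2_H3 : MemLpSobolev 2 3 T (u 1)
  mem_C_Hs : ∀ i, ∀ s ∈ Ico (0 : ℝ) 1, MemCSobolev s T (u i)
  equation : ∃ du : Fin 2 → ℝ → Functional,
    (∀ i, IsWeakTimeDeriv T (u i) (du i) ∧ MemL2Dual T (du i)) ∧
    (∀ φ : testFunctions, ∀ᵐ t ∂timeMeasure T,
      du 0 t φ + ν * gradPairing (u 0 t) φ + transportPairing (fun j => u j t) (u 0 t) φ = 0) ∧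
    (∀ φ : testFunctions, ∀ᵐ t ∂timeMeasure T,
      du 1 t φ + pairing (weakLaplacian (u 1 t)) (classicalLaplacian φ)
        + transportPairing (fun j => u j t) (u 1 t) φ = lam * gradPairing (u 1 t) φ)

end RKSE

end

/-! Let M be the essential supremum of the initial first component. Take an even smooth cutoff c ≥ 0
vanishing exactly on [-M, M], its odd primitive τ, and the primitive E of τ (`cutoff`, `truncation`,
`excess`). Then E is convex, nonnegative, and zero exactly on [-M, M], so the claim is that y(t) = ∫
E(u₁(t)), which starts at 0, stays at 0.

Formally y' = ∫ τ(u₁)(νΔu₁ - u·∇u₁), and the viscous term equals -ν∫ c(u₁)|∇u₁|²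
(`integral_truncation_mul_eq`). The velocity is not divergence free, so the transport term does not
cancel. However τ² ≤ 2cE (`sq_truncation_le`), so Young's inequality absorbs it into the dissipation
and leaves y' ≤ (K²/ν) y, where K(t) bounds |u₁| and |u₂| (`inner_truncationL2_rhs_le`). Only the
size of the drift matters, not its divergence. The embedding H² ⊂ L^∞ (`ae_abs_le_sobolevNorm`)
controls K by the H² norm of u₁ and the H³ norm of u₂, which are square integrable in time. Hence K²
is integrable and Gronwall gives y = 0.

The chain rule in time is avoided. The equation and the regularity give ∂ₜu₁ = g with g(t) in L² and
‖g(t)‖ integrable in t. Convexity gives y(t) - y(x) ≤ ⟨τ(u₁(t)), u₁(t) - u₁(x)⟩, and the weak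
equation turns the right side into ∫ₓᵗ ⟨g(r), τ(u₁(t))⟩ dr. Replacing τ(u₁(t)) by τ(u₁(r)) costs
little for t near x, because u₁ is continuous into L² and τ is 1-Lipschitz. This local growth bound
is all that the Gronwall principle `nonpos_of_local_growth` needs. -/

noncomputable section

namespace RKSE

/-! ### Fourier monomials as a Hilbert basis of L²(𝕋²; ℂ) -/

open scoped ComplexConjugate

/-- The complex Hilbert space `L²(𝕋²; ℂ)`. -/
abbrev L2C : Type := Lp ℂ 2 (volume : Measure Torus)

/-- The Fourier monomial `x ↦ e^{ik·x}`. -/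
def monomial (k : Fin 2 → ℤ) : C(Torus, ℂ) where
  toFun x := ∏ j, fourier (k j) (x j)
  continuous_toFun := by fun_prop

theorem monomial_apply (k : Fin 2 → ℤ) (x : Torus) :
    monomial k x = ∏ j, fourier (k j) (x j) := rfl

theorem monomial_neg (k : Fin 2 → ℤ) (x : Torus) :
    monomial (-k) x = conj (monomial k x) := by
  simp only [monomial_apply, Pi.neg_apply, fourier_neg, map_prod]

theorem monomial_add (k l : Fin 2 → ℤ) (x : Torus) :
    monomial (k + l) x = monomial k x * monomial l x := by
  simp only [monomial_apply, Pi.add_apply, fourier_add, ← Finset.prod_mul_distrib]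

theorem norm_monomial_apply (k : Fin 2 → ℤ) (x : Torus) : ‖monomial k x‖ = 1 := by
  simp only [monomial_apply, fourier_apply, norm_prod, Circle.norm_coe, Finset.prod_const_one]

theorem monomial_single (j : Fin 2) (x : Torus) :
    monomial (Pi.single j 1) x = fourier 1 (x j) := by
  fin_cases j <;> simp [monomial_apply, Fin.prod_univ_two]

/-- The star subalgebra of `C(𝕋², ℂ)` generated by the Fourier monomials. -/
def monomialSubalgebra : StarSubalgebra ℂ C(Torus, ℂ) where
  toSubalgebra := Algebra.adjoin ℂ (range monomial)
  star_mem' := by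
    change Algebra.adjoin ℂ (range monomial) ≤ star (Algebra.adjoin ℂ (range monomial))
    refine Algebra.adjoin_le ?_
    rintro _ ⟨n, rfl⟩
    refine Algebra.subset_adjoin ⟨-n, ?_⟩
    ext1 x
    simp only [monomial_neg, starRingEnd_apply, ContinuousMap.star_apply]

/-- A product of monomials is a monomial and the constant 1 is the monomial of frequency 0, so the
generated algebra is no larger than the linear span. -/
theorem monomialSubalgebra_coe :
    monomialSubalgebra.toSubalgebra.toSubmodule = Submodule.span ℂ (range monomial) := by
  apply Algebra.adjoin_eq_span_of_subset
  refine .trans (fun x ↦ Submonoid.closure_induction (fun _ ↦ id) ⟨0, ?_⟩ ?_) Submodule.subset_span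
  · ext z
    simp [monomial_apply]
  · rintro _ _ _ _ ⟨m, rfl⟩ ⟨n, rfl⟩
    exact ⟨m + n, by ext z; exact monomial_add m n z⟩

theorem monomialSubalgebra_separatesPoints : monomialSubalgebra.SeparatesPoints := by
  intro x y hxy
  rw [Ne, funext_iff, not_forall] at hxy
  obtain ⟨i, hi⟩ := hxy
  refine ⟨_, ⟨monomial (Pi.single i 1), Algebra.subset_adjoin ⟨Pi.single i 1, rfl⟩, rfl⟩, ?_⟩
  dsimp only
  rw [monomial_single, monomial_single, fourier_one, fourier_one]
  exact fun h => hi (AddCircle.injective_toCircle Real.two_pi_pos.ne' (Circle.coe_injective h))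

/-- Stone–Weierstrass: the monomials of frequency e₁ and e₂ already separate points. -/
theorem span_monomial_closure_eq_top :
    (Submodule.span ℂ (range monomial)).topologicalClosure = ⊤ := by
  rw [← monomialSubalgebra_coe]
  exact congr_arg (Subalgebra.toSubmodule <| StarSubalgebra.toSubalgebra ·)
    (ContinuousMap.starSubalgebra_topologicalClosure_eq_top_of_separatesPoints _
      monomialSubalgebra_separatesPoints)

/-- The Fourier monomials as elements of `L²(𝕋²; ℂ)`. -/
def monomialLp (k : Fin 2 → ℤ) : L2C := ContinuousMap.toLp (E := ℂ) 2 volume ℂ (monomial k)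

theorem coeFn_monomialLp (k : Fin 2 → ℤ) : monomialLp k =ᵐ[volume] monomial k :=
  ContinuousMap.coeFn_toLp volume (monomial k)

theorem span_monomialLp_closure_eq_top :
    (Submodule.span ℂ (range monomialLp)).topologicalClosure = ⊤ := by
  have := (ContinuousMap.toLp_denseRange ℂ (volume : Measure Torus) ℂ
    (p := 2) (by simp)).topologicalClosure_map_submodule span_monomial_closure_eq_top
  rw [Submodule.map_span, ← range_comp] at this
  exact this

theorem integral_fourier (n : ℤ) :
    ∫ x : AddCircle (2 * Real.pi), fourier n x = if n = 0 then (2 * Real.pi : ℂ) else 0 := by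
  have h := fourierCoeff_fourier (T := 2 * Real.pi) n
  have h0 := congrFun h 0
  simp only [fourierCoeff, neg_zero, fourier_zero, one_smul] at h0
  rw [AddCircle.integral_haarAddCircle] at h0
  have hpi : (2 * Real.pi : ℂ) ≠ 0 := by
    exact_mod_cast Real.two_pi_pos.ne'
  rw [Complex.real_smul, Complex.ofReal_inv, inv_mul_eq_iff_eq_mul₀ (by exact_mod_cast hpi)] at h0
  rw [h0]
  by_cases hn : n = 0
  · simp [hn]
  · simp [hn, Ne.symm hn]

theorem integral_monomial (k : Fin 2 → ℤ) :
    ∫ x, monomial k x = if k = 0 then ((2 * Real.pi) ^ 2 : ℂ) else 0 := by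
  simp only [monomial_apply]
  rw [MeasureTheory.integral_fintype_prod_volume_eq_prod
    (f := fun j : Fin 2 => fun y : AddCircle (2 * Real.pi) => fourier (k j) y)]
  simp only [integral_fourier, Fin.prod_univ_two, funext_iff, Fin.forall_fin_two, Pi.zero_apply]
  split_ifs <;> simp_all [sq]

theorem inner_monomialLp (k l : Fin 2 → ℤ) :
    inner ℂ (monomialLp k) (monomialLp l) = if k = l then ((2 * Real.pi) ^ 2 : ℂ) else 0 := by
  unfold monomialLp
  rw [ContinuousMap.inner_toLp]
  have : ∀ x, monomial l x * (starRingEnd ℂ) (monomial k x) = monomial (l + -k) x := by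
    intro x; rw [monomial_add, monomial_neg]
  simp only [this, integral_monomial]
  congr 1
  rw [← sub_eq_add_neg, sub_eq_zero]
  exact propext eq_comm

theorem two_pi_complex_ne_zero : (2 * Real.pi : ℂ) ≠ 0 := by
  exact_mod_cast Real.two_pi_pos.ne'

theorem orthonormal_monomialLp :
    Orthonormal ℂ (fun k => (2 * Real.pi : ℂ)⁻¹ • monomialLp k) := by
  rw [orthonormal_iff_ite]
  intro k l
  rw [inner_smul_left, inner_smul_right, inner_monomialLp]
  split_ifs
  · have := two_pi_complex_ne_zero
    rw [map_inv₀, map_mul, Complex.conj_ofReal, map_ofNat]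
    field_simp
  · simp

theorem span_normalized_monomialLp :
    Submodule.span ℂ (range fun k => (2 * Real.pi : ℂ)⁻¹ • monomialLp k)
      = Submodule.span ℂ (range monomialLp) := by
  apply le_antisymm
  · rw [Submodule.span_le]
    rintro _ ⟨k, rfl⟩
    exact Submodule.smul_mem _ _ (Submodule.subset_span ⟨k, rfl⟩)
  · rw [Submodule.span_le]
    rintro _ ⟨k, rfl⟩
    have := Submodule.smul_mem _ (2 * Real.pi : ℂ) (Submodule.subset_span (R := ℂ)
      (s := range fun k => (2 * Real.pi : ℂ)⁻¹ • monomialLp k) ⟨k, rfl⟩)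
    simpa [smul_smul, mul_inv_cancel₀ two_pi_complex_ne_zero, - mul_inv_rev] using this

/-- The Hilbert basis of normalized Fourier monomials of `L²(𝕋²; ℂ)`. -/
def torusBasis : HilbertBasis (Fin 2 → ℤ) ℂ L2C :=
  HilbertBasis.mk orthonormal_monomialLp
    (by rw [span_normalized_monomialLp]; exact span_monomialLp_closure_eq_top.ge)

theorem torusBasis_apply (k : Fin 2 → ℤ) :
    torusBasis k = (2 * Real.pi : ℂ)⁻¹ • monomialLp k :=
  congrFun (HilbertBasis.coe_mk _ _) k

/-! ### Fourier series of real L² functions -/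

/-- The inclusion of `L²(𝕋²; ℝ)` into `L²(𝕋²; ℂ)`. -/
def complexify : L2 →L[ℝ] L2C := Complex.ofRealCLM.compLpL 2 volume

theorem coeFn_complexify (f : L2) : complexify f =ᵐ[volume] fun x => (f x : ℂ) :=
  Complex.ofRealCLM.coeFn_compLpL f

/-- The real part `L²(𝕋²; ℂ) → L²(𝕋²; ℝ)`. -/
def realPart : L2C →L[ℝ] L2 := Complex.reCLM.compLpL 2 volume

theorem coeFn_realPart (f : L2C) : realPart f =ᵐ[volume] fun x => (f x).re :=
  Complex.reCLM.coeFn_compLpL f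

theorem realPart_complexify (f : L2) : realPart (complexify f) = f := by
  apply Lp.ext
  filter_upwards [coeFn_realPart (complexify f), coeFn_complexify f] with x h1 h2
  simp [h1, h2]

theorem norm_complexify (f : L2) : ‖complexify f‖ = ‖f‖ := by
  apply le_antisymm <;> refine Lp.norm_le_norm_of_ae_le ?_ <;>
  · filter_upwards [coeFn_complexify f] with x h
    simp [h]

theorem norm_realPart_le (f : L2C) : ‖realPart f‖ ≤ ‖f‖ := by
  refine Lp.norm_le_norm_of_ae_le ?_
  filter_upwards [coeFn_realPart f] with x h
  simpa [h] using Complex.abs_re_le_norm _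

theorem inner_monomialLp_complexify (k : Fin 2 → ℤ) (f : L2) :
    inner ℂ (monomialLp k) (complexify f) = (2 * Real.pi) ^ 2 * fourierCoefficient f k := by
  rw [fourierCoefficient, L2.inner_def]
  push_cast
  rw [mul_inv_cancel_left₀ (pow_ne_zero 2 two_pi_complex_ne_zero)]
  apply integral_congr_ae
  filter_upwards [coeFn_monomialLp k, coeFn_complexify f] with x h1 h2
  rw [h1, h2, RCLike.inner_apply, ← monomial_neg, monomial_apply]
  rfl

theorem torusBasis_repr_complexify (k : Fin 2 → ℤ) (f : L2) :
    torusBasis.repr (complexify f) k = 2 * Real.pi * fourierCoefficient f k := by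
  rw [HilbertBasis.repr_apply_apply, torusBasis_apply, inner_smul_left,
    inner_monomialLp_complexify, map_inv₀, map_mul, Complex.conj_ofReal, map_ofNat]
  have := two_pi_complex_ne_zero
  field_simp

/-- Makes Sobolev norms measurable in time along a strongly measurable curve in L². -/
theorem continuous_fourierCoefficient (k : Fin 2 → ℤ) :
    Continuous fun f : L2 => fourierCoefficient f k := by
  have : (fun f : L2 => fourierCoefficient f k)
      = fun f : L2 => (((2 * Real.pi) ^ 2 : ℂ))⁻¹ * inner ℂ (monomialLp k) (complexify f) := by
    funext f
    rw [inner_monomialLp_complexify,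
      inv_mul_cancel_left₀ (pow_ne_zero 2 two_pi_complex_ne_zero)]
  rw [this]
  fun_prop

theorem hasSum_fourier (f : L2) :
    HasSum (fun k => fourierCoefficient f k • monomialLp k) (complexify f) := by
  have := torusBasis.hasSum_repr (complexify f)
  simp only [torusBasis_repr_complexify, torusBasis_apply, smul_smul] at this
  convert this using 3
  have := two_pi_complex_ne_zero
  field_simp

theorem hasSum_sq_fourierCoefficient (f : L2) :
    HasSum (fun k => (2 * Real.pi) ^ 2 * ‖fourierCoefficient f k‖ ^ 2) (‖f‖ ^ 2) := by
  have h := lp.hasSum_norm (p := 2) (by norm_num) (torusBasis.repr (complexify f))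
  simp only [torusBasis_repr_complexify, LinearIsometryEquiv.norm_map, norm_complexify] at h
  norm_num [mul_pow] at h
  convert h using 2
  ring

/-- Any square summable family is the family of coefficients of an `L²` Fourier series. -/
theorem exists_hasSum_monomialLp {c : (Fin 2 → ℤ) → ℂ} (hc : Summable fun k => ‖c k‖ ^ 2) :
    ∃ F : L2C, HasSum (fun k => c k • monomialLp k) F
      ∧ ‖F‖ ^ 2 = (2 * Real.pi) ^ 2 * ∑' k, ‖c k‖ ^ 2 := by
  have hmem : Memℓp (fun k => (2 * Real.pi : ℂ) * c k) 2 := by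
    rw [memℓp_gen_iff (by norm_num)]
    norm_num [mul_pow]
    exact hc.mul_left _
  refine ⟨torusBasis.repr.symm ⟨_, hmem⟩, ?_, ?_⟩
  · have := torusBasis.hasSum_repr_symm ⟨_, hmem⟩
    convert this using 2 with k
    rw [torusBasis_apply, smul_smul]
    congr 1
    have := two_pi_complex_ne_zero
    change _ = (2 * Real.pi : ℂ) * c k * _
    field_simp
  · rw [LinearIsometryEquiv.norm_map]
    have h := (lp.hasSum_norm (p := 2) (by norm_num) (⟨_, hmem⟩ : lp (fun _ : Fin 2 → ℤ => ℂ) 2))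
    norm_num [mul_pow] at h
    rw [← h.tsum_eq, tsum_mul_left]
    ring

/-! ### Calculus of smooth functions on the torus -/

/-- The covering map `ℝ² → 𝕋²`. -/
def toTorus (y : Fin 2 → ℝ) : Torus := fun i => (y i : AddCircle (2 * Real.pi))

theorem toTorus_surjective : Function.Surjective toTorus := fun x => by
  choose y hy using fun i => QuotientAddGroup.mk_surjective (x i)
  exact ⟨y, funext hy⟩

theorem isOpenQuotientMap_toTorus : IsOpenQuotientMap toTorus :=
  IsOpenQuotientMap.piMap fun _ => QuotientAddGroup.isOpenQuotientMap_mk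

theorem toTorus_add_single (y : Fin 2 → ℝ) (j : Fin 2) (h : ℝ) :
    toTorus y + Pi.single j (h : AddCircle (2 * Real.pi)) = toTorus (y + h • Pi.single j 1) := by
  funext i
  by_cases hi : i = j
  · subst hi; simp [toTorus]
  · simp [toTorus, hi]

theorem mem_testFunctions {φ : Torus → ℝ} :
    φ ∈ testFunctions ↔ ContDiff ℝ ∞ (fun y => φ (toTorus y)) := Iff.rfl

theorem continuous_of_mem_testFunctions {φ : Torus → ℝ} (hφ : φ ∈ testFunctions) :
    Continuous φ :=
  isOpenQuotientMap_toTorus.isQuotientMap.continuous_iff.2 (mem_testFunctions.1 hφ).continuous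

theorem hasDerivAt_translate_zero {φ : Torus → ℝ} (hφ : φ ∈ testFunctions) (j : Fin 2)
    (y : Fin 2 → ℝ) :
    HasDerivAt (fun h : ℝ => φ (toTorus y + Pi.single j (h : AddCircle (2 * Real.pi))))
      (fderiv ℝ (fun y => φ (toTorus y)) y (Pi.single j 1)) 0 := by
  simp only [toTorus_add_single]
  have h1 : HasFDerivAt (fun y => φ (toTorus y)) (fderiv ℝ (fun y => φ (toTorus y)) y)
      (y + (0 : ℝ) • Pi.single j 1) := by
    rw [zero_smul, add_zero]
    exact ((mem_testFunctions.1 hφ).differentiable (by simp) y).hasFDerivAt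
  have h2 : HasDerivAt (fun h : ℝ => y + h • (Pi.single j 1 : Fin 2 → ℝ)) (Pi.single j 1) 0 := by
    simpa using ((hasDerivAt_id (0 : ℝ)).smul_const (Pi.single j 1 : Fin 2 → ℝ)).const_add y
  exact h1.comp_hasDerivAt 0 h2

theorem classicalPartial_toTorus {φ : Torus → ℝ} (hφ : φ ∈ testFunctions) (j : Fin 2)
    (y : Fin 2 → ℝ) :
    classicalPartial j φ (toTorus y) = fderiv ℝ (fun y => φ (toTorus y)) y (Pi.single j 1) :=
  (hasDerivAt_translate_zero hφ j y).deriv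

theorem classicalPartial_mem {φ : Torus → ℝ} (hφ : φ ∈ testFunctions) (j : Fin 2) :
    classicalPartial j φ ∈ testFunctions := by
  rw [mem_testFunctions]
  simp only [classicalPartial_toTorus hφ]
  exact ((mem_testFunctions.1 hφ).fderiv_right (m := ∞) (by simp)).clm_apply contDiff_const

theorem hasDerivAt_translate {φ : Torus → ℝ} (hφ : φ ∈ testFunctions) (j : Fin 2)
    (x : Torus) (h : ℝ) :
    HasDerivAt (fun h : ℝ => φ (x + Pi.single j (h : AddCircle (2 * Real.pi))))
      (classicalPartial j φ (x + Pi.single j (h : AddCircle (2 * Real.pi)))) h := by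
  obtain ⟨y, rfl⟩ := toTorus_surjective x
  have h1 := hasDerivAt_translate_zero hφ j (y + h • Pi.single j 1)
  rw [← classicalPartial_toTorus hφ, ← toTorus_add_single] at h1
  have h2 : HasDerivAt (fun r : ℝ => r - h) 1 h := (hasDerivAt_id h).sub_const h
  have h3 := HasDerivAt.comp (h₂ := fun r : ℝ => φ (toTorus y
    + Pi.single j (h : AddCircle (2 * Real.pi)) + Pi.single j (r : AddCircle (2 * Real.pi))))
    h ((sub_self h).symm ▸ h1) h2
  rw [mul_one] at h3
  refine h3.congr_of_eventuallyEq (Eventually.of_forall fun r => ?_)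
  simp only [Function.comp_apply, add_assoc, ← Pi.single_add, ← AddCircle.coe_add]
  congr 4
  ring

theorem hasDerivAt_translate_at_zero {φ : Torus → ℝ} (hφ : φ ∈ testFunctions) (j : Fin 2)
    (x : Torus) :
    HasDerivAt (fun h : ℝ => φ (x + Pi.single j (h : AddCircle (2 * Real.pi))))
      (classicalPartial j φ x) 0 := by
  simpa using hasDerivAt_translate hφ j x 0

theorem mul_mem_testFunctions {φ ψ : Torus → ℝ} (hφ : φ ∈ testFunctions)
    (hψ : ψ ∈ testFunctions) : (fun x => φ x * ψ x) ∈ testFunctions := by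
  rw [mem_testFunctions] at *
  exact hφ.mul hψ

theorem comp_mem_testFunctions {β : ℝ → ℝ} (hβ : ContDiff ℝ ∞ β) {φ : Torus → ℝ}
    (hφ : φ ∈ testFunctions) : (fun x => β (φ x)) ∈ testFunctions := by
  rw [mem_testFunctions] at *
  exact hβ.comp hφ

theorem classicalPartial_mul {φ ψ : Torus → ℝ} (hφ : φ ∈ testFunctions)
    (hψ : ψ ∈ testFunctions) (j : Fin 2) (x : Torus) :
    classicalPartial j (fun x => φ x * ψ x) x
      = classicalPartial j φ x * ψ x + φ x * classicalPartial j ψ x := by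
  have h := ((hasDerivAt_translate_at_zero hφ j x).fun_mul
    (hasDerivAt_translate_at_zero hψ j x)).deriv
  simp only [AddCircle.coe_zero, Pi.single_zero, add_zero] at h
  exact h

theorem classicalPartial_comp {β β' : ℝ → ℝ} (hβ : ∀ z, HasDerivAt β (β' z) z) {φ : Torus → ℝ}
    (hφ : φ ∈ testFunctions) (j : Fin 2) (x : Torus) :
    classicalPartial j (fun x => β (φ x)) x = β' (φ x) * classicalPartial j φ x := by
  have h1 := hasDerivAt_translate_at_zero hφ j x
  have h2 : HasDerivAt β (β' (φ x)) (φ (x + Pi.single j ((0 : ℝ) : AddCircle (2 * Real.pi)))) := by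
    simpa using hβ (φ x)
  exact (h2.comp 0 h1).deriv

theorem exists_bound_of_continuous {φ : Torus → ℝ} (hφ : Continuous φ) :
    ∃ C, 0 ≤ C ∧ ∀ x, |φ x| ≤ C := by
  obtain ⟨C, hC⟩ := isCompact_univ.exists_bound_of_continuousOn hφ.continuousOn
  exact ⟨C, (norm_nonneg _).trans (hC 0 (mem_univ _)), fun x => hC x (mem_univ x)⟩

theorem integrable_of_continuous {φ : Torus → ℝ} (hφ : Continuous φ) : Integrable φ := by
  obtain ⟨C, -, hC⟩ := exists_bound_of_continuous hφ
  exact Integrable.of_bound hφ.aestronglyMeasurable C (Eventually.of_forall hC)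

theorem integral_translate (φ : Torus → ℝ) (a : Torus) : ∫ x, φ (x + a) = ∫ x, φ x :=
  integral_add_right_eq_self φ a

/-- By translation invariance ∫ φ(x + h eⱼ) dx does not depend on h; differentiate under the
integral at h = 0. -/
theorem integral_classicalPartial {φ : Torus → ℝ} (hφ : φ ∈ testFunctions) (j : Fin 2) :
    ∫ x, classicalPartial j φ x = 0 := by
  have hc := continuous_of_mem_testFunctions hφ
  have hd := continuous_of_mem_testFunctions (classicalPartial_mem hφ j)
  obtain ⟨C, -, hC⟩ := exists_bound_of_continuous hd
  have ht : ∀ {ψ : Torus → ℝ}, Continuous ψ → ∀ h : ℝ,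
      Continuous fun x : Torus => ψ (x + Pi.single j (h : AddCircle (2 * Real.pi))) := fun hψ h => by
    fun_prop
  have key : HasDerivAt
      (fun h : ℝ => ∫ x : Torus, φ (x + Pi.single j (h : AddCircle (2 * Real.pi))))
      (∫ x : Torus, classicalPartial j φ (x + Pi.single j ((0 : ℝ) : AddCircle (2 * Real.pi)))) 0 :=
    (hasDerivAt_integral_of_dominated_loc_of_deriv_le (bound := fun _ => C) univ_mem
      (Eventually.of_forall fun h => (ht hc h).aestronglyMeasurable)
      (integrable_of_continuous (ht hc 0))
      (ht hd 0).aestronglyMeasurable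
      (Eventually.of_forall fun x h _ => hC _) (integrable_const C)
      (Eventually.of_forall fun x h _ => hasDerivAt_translate hφ j x h)).2
  simp only [integral_translate] at key
  exact key.unique (hasDerivAt_const (0 : ℝ) _)

theorem integral_mul_classicalPartial {φ ψ : Torus → ℝ} (hφ : φ ∈ testFunctions)
    (hψ : ψ ∈ testFunctions) (j : Fin 2) :
    ∫ x, φ x * classicalPartial j ψ x = -∫ x, classicalPartial j φ x * ψ x := by
  have h := integral_classicalPartial (mul_mem_testFunctions hφ hψ) j
  simp only [classicalPartial_mul hφ hψ] at h
  have c1 := continuous_of_mem_testFunctions hφ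
  have c2 := continuous_of_mem_testFunctions hψ
  have c3 := continuous_of_mem_testFunctions (classicalPartial_mem hφ j)
  have c4 := continuous_of_mem_testFunctions (classicalPartial_mem hψ j)
  rw [integral_add (f := fun x => classicalPartial j φ x * ψ x)
    (g := fun x => φ x * classicalPartial j ψ x) (integrable_of_continuous (c3.mul c2))
    (integrable_of_continuous (c1.mul c4))] at h
  linarith

/-! ### Real waves and their derivatives -/

/-- The real part of a multiple of a Fourier monomial. -/
def wave (c : ℂ) (k : Fin 2 → ℤ) : Torus → ℝ := fun x => (c * monomial k x).re

theorem monomial_toTorus (k : Fin 2 → ℤ) (y : Fin 2 → ℝ) :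
    monomial k (toTorus y) = Complex.exp (Complex.I * ((∑ j, k j * y j : ℝ) : ℂ)) := by
  have hpi : (Real.pi : ℂ) ≠ 0 := by exact_mod_cast Real.pi_ne_zero
  simp only [monomial_apply, toTorus, fourier_coe_apply, Fin.prod_univ_two, Fin.sum_univ_two]
  rw [← Complex.exp_add]
  congr 1
  push_cast
  field_simp

theorem contDiff_monomial_toTorus (k : Fin 2 → ℤ) :
    ContDiff ℝ ∞ fun y => monomial k (toTorus y) := by
  simp only [monomial_toTorus]
  have h : ContDiff ℝ ∞ fun y : Fin 2 → ℝ => ∑ j, (k j : ℝ) * y j :=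
    ContDiff.sum fun j _ => contDiff_const.mul (contDiff_apply (ι := Fin 2) ℝ ℝ j)
  exact ContDiff.cexp (contDiff_const.mul (Complex.ofRealCLM.contDiff.comp h))

theorem wave_mem (c : ℂ) (k : Fin 2 → ℤ) : wave c k ∈ testFunctions := by
  rw [mem_testFunctions]
  exact Complex.reCLM.contDiff.comp (contDiff_const.mul (contDiff_monomial_toTorus k))

theorem classicalPartial_wave (c : ℂ) (k : Fin 2 → ℤ) (j : Fin 2) :
    classicalPartial j (wave c k) = wave (c * (Complex.I * k j)) k := by
  funext x
  obtain ⟨y, rfl⟩ := toTorus_surjective x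
  have hd : HasDerivAt (fun h : ℝ => monomial k (toTorus (y + h • Pi.single j 1)))
      (Complex.I * k j * monomial k (toTorus y)) 0 := by
    simp only [monomial_toTorus]
    have h0 : HasDerivAt (fun h : ℝ => ∑ i, (k i : ℝ) * (y + h • (Pi.single j 1 : Fin 2 → ℝ)) i)
        (k j : ℝ) 0 := by
      have : (fun h : ℝ => ∑ i, (k i : ℝ) * (y + h • (Pi.single j 1 : Fin 2 → ℝ)) i)
          = fun h : ℝ => ∑ i, (k i : ℝ) * y i + (k j : ℝ) * h := by
        funext h
        simp only [Pi.add_apply, Pi.smul_apply, smul_eq_mul, mul_add, Finset.sum_add_distrib,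
          Pi.single_apply]
        simp
      rw [this]
      simpa using ((hasDerivAt_id (0 : ℝ)).const_mul (k j : ℝ)).const_add (∑ i, (k i : ℝ) * y i)
    have h1 := ((h0.ofReal_comp).const_mul Complex.I).cexp
    convert h1 using 1
    simp only [zero_smul, add_zero]
    push_cast
    ring
  have h2 := Complex.reCLM.hasFDerivAt.comp_hasDerivAt (0 : ℝ) (hd.const_mul c)
  simp only [classicalPartial, toTorus_add_single]
  refine (h2.deriv.trans ?_)
  simp only [wave, Complex.reCLM_apply]
  congr 1
  ring

theorem classicalPartial_sum {ι : Type*} (s : Finset ι) {φ : ι → Torus → ℝ}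
    (hφ : ∀ i ∈ s, φ i ∈ testFunctions) (j : Fin 2) :
    classicalPartial j (fun x => ∑ i ∈ s, φ i x) = fun x => ∑ i ∈ s, classicalPartial j (φ i) x := by
  funext x
  exact (HasDerivAt.fun_sum fun i hi => hasDerivAt_translate_at_zero (hφ i hi) j x).deriv

/-! ### Weak partial derivatives and their Fourier coefficients -/

theorem memLp_of_mem_testFunctions {φ : Torus → ℝ} (hφ : φ ∈ testFunctions) :
    MemLp φ 2 (volume : Measure Torus) := by
  have hc := continuous_of_mem_testFunctions hφ
  obtain ⟨C, -, hC⟩ := exists_bound_of_continuous hc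
  exact MemLp.of_bound hc.aestronglyMeasurable C (Eventually.of_forall hC)

/-- The inclusion of `C^∞(𝕋²)` into `L²(𝕋²)`. -/
def testL2 : testFunctions →ₗ[ℝ] L2 where
  toFun φ := (memLp_of_mem_testFunctions φ.2).toLp φ
  map_add' φ ψ := MemLp.toLp_add (memLp_of_mem_testFunctions φ.2) (memLp_of_mem_testFunctions ψ.2)
  map_smul' c φ := MemLp.toLp_const_smul c (memLp_of_mem_testFunctions φ.2)

theorem coeFn_testL2 (φ : testFunctions) : testL2 φ =ᵐ[volume] (φ : Torus → ℝ) :=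
  (memLp_of_mem_testFunctions φ.2).coeFn_toLp

/-- The classical partial derivative as a map of `C^∞(𝕋²)` into itself. -/
def testPartial (j : Fin 2) (φ : testFunctions) : testFunctions :=
  ⟨classicalPartial j φ, classicalPartial_mem φ.2 j⟩

theorem pairing_eq_inner (f g : L2) : pairing f g = inner ℝ f g := by
  rw [pairing, L2.inner_def]
  simp [mul_comm]

theorem pairing_congr {f f' g g' : Torus → ℝ} (hf : f =ᵐ[volume] f') (hg : g =ᵐ[volume] g') :
    pairing f g = pairing f' g' :=
  integral_congr_ae (hf.mul hg)

theorem pairing_test (f : L2) (φ : testFunctions) : pairing f φ = inner ℝ f (testL2 φ) := by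
  rw [← pairing_eq_inner]
  exact pairing_congr ae_eq_rfl (coeFn_testL2 φ).symm

theorem isWeakPartial_iff {j : Fin 2} {f g : L2} :
    IsWeakPartial j f g ↔ ∀ φ, inner ℝ f (testL2 (testPartial j φ)) = -inner ℝ g (testL2 φ) := by
  constructor
  · intro h φ
    rw [← pairing_test, ← pairing_test]
    exact h φ φ.2
  · intro h φ hφ
    have := h ⟨φ, hφ⟩
    rwa [← pairing_test, ← pairing_test] at this

theorem isWeakPartial_testL2 (j : Fin 2) (φ : testFunctions) :
    IsWeakPartial j (testL2 φ) (testL2 (testPartial j φ)) := by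
  intro ψ hψ
  rw [pairing_congr (coeFn_testL2 φ) ae_eq_rfl,
    pairing_congr (coeFn_testL2 (testPartial j φ)) ae_eq_rfl]
  exact integral_mul_classicalPartial φ.2 hψ j

/-- The weak derivative is a closed operator, since both sides of its defining identity are
continuous in L². -/
theorem IsWeakPartial.of_tendsto {ι : Type*} {l : Filter ι} [l.NeBot] {j : Fin 2}
    {F P : ι → L2} {f p : L2} (h : ∀ i, IsWeakPartial j (F i) (P i)) (hF : Tendsto F l (𝓝 f))
    (hP : Tendsto P l (𝓝 p)) : IsWeakPartial j f p := by
  rw [isWeakPartial_iff]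
  intro φ
  refine tendsto_nhds_unique (hF.inner tendsto_const_nhds)
    (((hP.inner tendsto_const_nhds).neg).congr fun i => ?_)
  exact (isWeakPartial_iff.1 (h i) φ).symm

/-- The trigonometric polynomial `∑_{k ∈ S} Re (c_k e^{ik·x})`. -/
def trigPolynomial (c : (Fin 2 → ℤ) → ℂ) (S : Finset (Fin 2 → ℤ)) : testFunctions :=
  ∑ k ∈ S, ⟨wave (c k) k, wave_mem (c k) k⟩

theorem trigPolynomial_apply (c : (Fin 2 → ℤ) → ℂ) (S : Finset (Fin 2 → ℤ)) (x : Torus) :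
    (trigPolynomial c S : Torus → ℝ) x = ∑ k ∈ S, wave (c k) k x := by
  simp [trigPolynomial, Finset.sum_apply]

theorem testL2_wave (c : ℂ) (k : Fin 2 → ℤ) :
    testL2 ⟨wave c k, wave_mem c k⟩ = realPart (c • monomialLp k) := by
  apply Lp.ext
  filter_upwards [coeFn_testL2 ⟨wave c k, wave_mem c k⟩, coeFn_realPart (c • monomialLp k),
    Lp.coeFn_smul c (monomialLp k), coeFn_monomialLp k] with x h1 h2 h3 h4
  rw [h1, h2, h3, Pi.smul_apply, h4]
  rfl

theorem testL2_trigPolynomial (c : (Fin 2 → ℤ) → ℂ) (S : Finset (Fin 2 → ℤ)) :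
    testL2 (trigPolynomial c S) = realPart (∑ k ∈ S, c k • monomialLp k) := by
  simp only [trigPolynomial, map_sum, testL2_wave]

theorem testPartial_trigPolynomial (c : (Fin 2 → ℤ) → ℂ) (S : Finset (Fin 2 → ℤ)) (j : Fin 2) :
    testPartial j (trigPolynomial c S)
      = trigPolynomial (fun k => c k * (Complex.I * k j)) S := by
  apply Subtype.ext
  funext x
  have : (trigPolynomial c S : Torus → ℝ) = fun x => ∑ k ∈ S, wave (c k) k x :=
    funext (trigPolynomial_apply c S)
  rw [trigPolynomial_apply, testPartial]
  simp only [this, classicalPartial_sum S (fun k _ => wave_mem (c k) k), classicalPartial_wave]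

theorem abs_trigPolynomial_le (c : (Fin 2 → ℤ) → ℂ) (S : Finset (Fin 2 → ℤ)) (x : Torus) :
    |(trigPolynomial c S : Torus → ℝ) x| ≤ ∑ k ∈ S, ‖c k‖ := by
  rw [trigPolynomial_apply]
  refine (Finset.abs_sum_le_sum_abs _ _).trans (Finset.sum_le_sum fun k _ => ?_)
  refine (Complex.abs_re_le_norm _).trans ?_
  rw [norm_mul, norm_monomial_apply, mul_one]

theorem tendsto_testL2_trigPolynomial {c : (Fin 2 → ℤ) → ℂ} {F : L2C}
    (h : HasSum (fun k => c k • monomialLp k) F) :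
    Tendsto (fun S => testL2 (trigPolynomial c S)) atTop (𝓝 (realPart F)) := by
  simp only [testL2_trigPolynomial]
  exact (realPart.continuous.tendsto F).comp h

theorem tendsto_trigPolynomial_fourier (f : L2) :
    Tendsto (fun S => testL2 (trigPolynomial (fourierCoefficient f) S)) atTop (𝓝 f) := by
  simpa only [realPart_complexify] using tendsto_testL2_trigPolynomial (hasSum_fourier f)

theorem denseRange_testL2 : DenseRange testL2 := fun f =>
  mem_closure_of_tendsto (tendsto_trigPolynomial_fourier f) (Eventually.of_forall fun _ => ⟨_, rfl⟩)

theorem eq_of_inner_testL2_eq {f g : L2} (h : ∀ φ, inner ℝ f (testL2 φ) = inner ℝ g (testL2 φ)) :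
    f = g :=
  denseRange_testL2.eq_of_inner_left ℝ h

theorem IsWeakPartial.unique {j : Fin 2} {f g g' : L2} (h : IsWeakPartial j f g)
    (h' : IsWeakPartial j f g') : g = g' :=
  eq_of_inner_testL2_eq fun φ => by
    have := (isWeakPartial_iff.1 h φ).symm.trans (isWeakPartial_iff.1 h' φ)
    exact neg_injective this

theorem IsWeakPartial.weakPartial_eq {j : Fin 2} {f g : L2} (h : IsWeakPartial j f g) :
    weakPartial j f = g := by
  have hex : ∃ g, IsWeakPartial j f g := ⟨g, h⟩
  rw [weakPartial, dif_pos hex]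
  exact hex.choose_spec.unique h

theorem pairing_wave_neg (f : L2) (c : ℂ) (k : Fin 2 → ℤ) :
    pairing f (wave c (-k)) = (c * ((2 * Real.pi) ^ 2 * fourierCoefficient f k)).re := by
  have hint : Integrable fun x => (f x : ℂ) * monomial (-k) x := by
    have h1 : Integrable fun x => (f x : ℂ) :=
      (Lp.memLp f |>.integrable (by norm_num)).ofReal
    refine h1.mul_bdd (c := 1) (monomial (-k)).continuous.aestronglyMeasurable
      (Eventually.of_forall fun x => (norm_monomial_apply _ x).le)
  have h : (2 * Real.pi) ^ 2 * fourierCoefficient f k = ∫ x, (f x : ℂ) * monomial (-k) x := by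
    rw [fourierCoefficient]
    push_cast
    rw [mul_inv_cancel_left₀ (pow_ne_zero 2 two_pi_complex_ne_zero)]
    rfl
  rw [h, ← integral_const_mul, pairing]
  have h2 := (Complex.reCLM.integral_comp_comm (hint.const_mul c)).symm
  simp only [Complex.reCLM_apply] at h2
  rw [h2]
  refine integral_congr_ae (Eventually.of_forall fun x => ?_)
  simp only [wave]
  rw [mul_left_comm, Complex.re_ofReal_mul]

/-- Test functions are real, so the test is made with Re(c e^{-ik·x}): c = 1 gives the real part of
the identity and c = -i the imaginary part. -/
theorem IsWeakPartial.fourierCoefficient_eq {j : Fin 2} {f g : L2} (h : IsWeakPartial j f g)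
    (k : Fin 2 → ℤ) :
    fourierCoefficient g k = fourierCoefficient f k * (Complex.I * k j) := by
  have key : ∀ c : ℂ, (c * ((2 * Real.pi) ^ 2 * fourierCoefficient g k)).re
      = (c * ((2 * Real.pi) ^ 2 * (fourierCoefficient f k * (Complex.I * k j)))).re := fun c => by
    have h1 := h _ (wave_mem c (-k))
    rw [classicalPartial_wave, pairing_wave_neg, pairing_wave_neg] at h1
    rw [← neg_eq_iff_eq_neg] at h1
    rw [← h1, ← Complex.neg_re]
    congr 1
    push_cast [Pi.neg_apply]
    ring
  have h3 : ((2 * Real.pi) ^ 2 * fourierCoefficient g k : ℂ)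
      = (2 * Real.pi) ^ 2 * (fourierCoefficient f k * (Complex.I * k j)) := by
    apply Complex.ext
    · simpa only [one_mul] using key 1
    · have := key (-Complex.I)
      simpa only [neg_mul, Complex.neg_re, Complex.I_mul_re, neg_neg] using this
  exact mul_left_cancel₀ (pow_ne_zero 2 two_pi_complex_ne_zero) h3

/-- An `L²` function with `k_j f̂(k)` square summable has a weak partial derivative, approximated
by the derivatives of the partial Fourier sums. -/
theorem exists_isWeakPartial {f : L2} {j : Fin 2}
    (h : Summable fun k : Fin 2 → ℤ => ‖fourierCoefficient f k * (Complex.I * k j)‖ ^ 2) :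
    ∃ p, IsWeakPartial j f p
      ∧ ‖p‖ ^ 2 ≤ (2 * Real.pi) ^ 2
        * ∑' k : Fin 2 → ℤ, ‖fourierCoefficient f k * (Complex.I * k j)‖ ^ 2
      ∧ Tendsto (fun S => testL2 (testPartial j (trigPolynomial (fourierCoefficient f) S)))
          atTop (𝓝 p) := by
  obtain ⟨P, hP, hn⟩ := exists_hasSum_monomialLp h
  have ht := tendsto_testL2_trigPolynomial hP
  simp only [← testPartial_trigPolynomial] at ht
  refine ⟨realPart P, ?_, ?_, ht⟩
  · exact IsWeakPartial.of_tendsto (fun S => isWeakPartial_testL2 j _)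
      (tendsto_trigPolynomial_fourier f) ht
  · rw [← hn]
    exact pow_le_pow_left₀ (norm_nonneg _) (norm_realPart_le P) 2

/-! ### Sobolev norms and H² regularity -/

theorem freqNorm_nonneg (k : Fin 2 → ℤ) : 0 ≤ freqNorm k := Real.sqrt_nonneg _

theorem abs_le_freqNorm (k : Fin 2 → ℤ) (j : Fin 2) : |(k j : ℝ)| ≤ freqNorm k :=
  Real.abs_le_sqrt (Finset.single_le_sum (f := fun j => (k j : ℝ) ^ 2)
    (fun _ _ => sq_nonneg _) (Finset.mem_univ j))

theorem norm_le_freqNorm (k : Fin 2 → ℤ) : ‖k‖ ≤ freqNorm k := by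
  refine (pi_norm_le_iff_of_nonneg (freqNorm_nonneg k)).2 fun j => ?_
  rw [Int.norm_eq_abs]
  exact abs_le_freqNorm k j

theorem hasSum_sobolevNorm {s : ℝ} {f : Torus → ℝ} (h : sobolevNorm s f < ⊤) :
    HasSum (fun k => (1 + freqNorm k ^ s) ^ 2 * ‖fourierCoefficient f k‖ ^ 2)
      ((sobolevNorm s f).toReal ^ 2) := by
  set g : (Fin 2 → ℤ) → ℝ := fun k => (1 + freqNorm k ^ s) ^ 2 * ‖fourierCoefficient f k‖ ^ 2
  have h0 : ∀ k, 0 ≤ g k := fun k => by positivity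
  have hne : ∑' k, ENNReal.ofReal (g k) ≠ ⊤ := by
    intro htop
    rw [sobolevNorm] at h
    simp [g] at htop
    simp [htop] at h
  have hsum : Summable g := by
    have := ENNReal.summable_toReal hne
    simpa only [ENNReal.toReal_ofReal (h0 _)] using this
  have heq : (sobolevNorm s f).toReal ^ 2 = ∑' k, g k := by
    rw [sobolevNorm, ← ENNReal.toReal_rpow, ← Real.sqrt_eq_rpow, Real.sq_sqrt
      ENNReal.toReal_nonneg, ENNReal.tsum_toReal_eq (fun k => ENNReal.ofReal_ne_top)]
    exact tsum_congr fun k => ENNReal.toReal_ofReal (h0 k)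
  rw [heq]
  exact hsum.hasSum

theorem aemeasurable_sobolevNorm {α : Type*} [MeasurableSpace α] {μ : Measure α} {f : α → L2}
    (hf : AEStronglyMeasurable f μ) (s : ℝ) : AEMeasurable (fun t => sobolevNorm s (f t)) μ := by
  unfold sobolevNorm
  refine AEMeasurable.pow_const (AEMeasurable.tsum fun k => ?_) _
  have h := (continuous_fourierCoefficient k).comp_aestronglyMeasurable hf
  exact ((h.norm.pow 2).const_mul _).aemeasurable.ennreal_ofReal

/-- At s = 0 the weight is (1 + 1)² = 4 for every k, including k = 0 because 0⁰ = 1. Against the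
Parseval factor (2π)² this leaves π². -/
theorem norm_eq_sobolevNorm_zero {f : L2} (h : sobolevNorm 0 f < ⊤) :
    ‖f‖ = Real.pi * (sobolevNorm 0 f).toReal := by
  have h1 := hasSum_sobolevNorm h
  simp only [Real.rpow_zero] at h1
  have h3 := hasSum_sq_fourierCoefficient f
  have h2 := (h1.mul_left (Real.pi ^ 2)).unique (by
    simpa only [show ∀ x : ℝ, (2 * Real.pi) ^ 2 * x = Real.pi ^ 2 * ((1 + 1) ^ 2 * x) from
      fun x => by ring] using h3)
  rw [← mul_pow] at h2
  exact ((pow_left_inj₀ (by positivity) (norm_nonneg _) two_ne_zero).1 h2).symm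

theorem tsum_le_of_sobolevNorm {s : ℝ} {f : L2} (h : sobolevNorm s f < ⊤)
    {c : (Fin 2 → ℤ) → ℂ} (hc : ∀ k, ‖c k‖ ≤ (1 + freqNorm k ^ s) * ‖fourierCoefficient f k‖) :
    Summable (fun k => ‖c k‖ ^ 2) ∧ ∑' k, ‖c k‖ ^ 2 ≤ (sobolevNorm s f).toReal ^ 2 := by
  have h1 := hasSum_sobolevNorm h
  have h2 : ∀ k, ‖c k‖ ^ 2 ≤ (1 + freqNorm k ^ s) ^ 2 * ‖fourierCoefficient f k‖ ^ 2 := fun k => by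
    rw [← mul_pow]
    exact pow_le_pow_left₀ (norm_nonneg _) (hc k) 2
  have hs : Summable fun k => ‖c k‖ ^ 2 := h1.summable.of_nonneg_of_le (fun _ => sq_nonneg _) h2
  refine ⟨hs, ?_⟩
  rw [← h1.tsum_eq]
  exact hs.tsum_le_tsum h2 h1.summable

/-- The second order weak derivatives of `f ∈ H²(𝕋²)`, their bounds, and approximation in `H¹` by
smooth functions. -/
theorem weakPartial_of_sobolevNorm_two {f : L2} (h : sobolevNorm 2 f < ⊤) :
    (∀ j, IsWeakPartial j f (weakPartial j f)
      ∧ IsWeakPartial j (weakPartial j f) (weakPartial j (weakPartial j f))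
      ∧ ‖weakPartial j f‖ ≤ 2 * Real.pi * (sobolevNorm 2 f).toReal
      ∧ ‖weakPartial j (weakPartial j f)‖ ≤ 2 * Real.pi * (sobolevNorm 2 f).toReal)
    ∧ ∃ φ : ℕ → testFunctions, Tendsto (fun n => testL2 (φ n)) atTop (𝓝 f)
      ∧ ∀ j, Tendsto (fun n => testL2 (testPartial j (φ n))) atTop (𝓝 (weakPartial j f)) := by
  have hN : 0 ≤ (sobolevNorm 2 f).toReal := ENNReal.toReal_nonneg
  have hle : ∀ {p : L2} {a : ℝ}, ‖p‖ ^ 2 ≤ (2 * Real.pi) ^ 2 * a →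
      a ≤ (sobolevNorm 2 f).toReal ^ 2 → ‖p‖ ≤ 2 * Real.pi * (sobolevNorm 2 f).toReal := by
    intro p a h1 h2
    refine le_of_sq_le_sq ?_ (by positivity)
    rw [mul_pow]
    exact h1.trans (by gcongr)
  have hc1 : ∀ (j : Fin 2) (k : Fin 2 → ℤ), ‖fourierCoefficient f k * (Complex.I * k j)‖
      ≤ (1 + freqNorm k ^ (2 : ℝ)) * ‖fourierCoefficient f k‖ := fun j k => by
    rw [norm_mul, norm_mul, Complex.norm_I, one_mul, Complex.norm_intCast, mul_comm, Real.rpow_two]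
    gcongr
    nlinarith [abs_le_freqNorm k j, sq_nonneg (freqNorm k - 1), freqNorm_nonneg k]
  have hc2 : ∀ (j : Fin 2) (k : Fin 2 → ℤ),
      ‖fourierCoefficient f k * (Complex.I * k j) * (Complex.I * k j)‖
      ≤ (1 + freqNorm k ^ (2 : ℝ)) * ‖fourierCoefficient f k‖ := fun j k => by
    rw [norm_mul, norm_mul, norm_mul, Complex.norm_I, one_mul, Complex.norm_intCast, mul_assoc,
      mul_comm, Real.rpow_two]
    gcongr
    nlinarith [abs_le_freqNorm k j, freqNorm_nonneg k, abs_nonneg (k j : ℝ)]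
  have h1 : ∀ j, IsWeakPartial j f (weakPartial j f)
      ∧ ‖weakPartial j f‖ ≤ 2 * Real.pi * (sobolevNorm 2 f).toReal
      ∧ Tendsto (fun S => testL2 (testPartial j (trigPolynomial (fourierCoefficient f) S)))
          atTop (𝓝 (weakPartial j f)) := fun j => by
    obtain ⟨hs, hb⟩ := tsum_le_of_sobolevNorm h (hc1 j)
    obtain ⟨p, hp, hpn, ht⟩ := exists_isWeakPartial hs
    rw [hp.weakPartial_eq]
    exact ⟨hp, hle hpn hb, ht⟩
  refine ⟨fun j => ⟨(h1 j).1, ?_⟩, ?_⟩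
  -- The coefficients of ∂ⱼf are f̂(k)·ikⱼ, so the existence result can be applied a second time, to
  -- ∂ⱼf itself.
  · have hco := (h1 j).1.fourierCoefficient_eq
    obtain ⟨hs, hb⟩ := tsum_le_of_sobolevNorm h (hc2 j)
    simp only [← hco] at hs hb
    obtain ⟨q, hq, hqn, -⟩ := exists_isWeakPartial hs
    rw [hq.weakPartial_eq]
    exact ⟨hq, (h1 j).2.1, hle hqn hb⟩
  -- A sequence of finite sets replaces the net of all finite sets, so that almost everywhere
  -- convergent subsequences can be extracted later.
  · obtain ⟨S, hS⟩ := exists_seq_tendsto (atTop : Filter (Finset (Fin 2 → ℤ)))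
    exact ⟨fun n => trigPolynomial (fourierCoefficient f) (S n),
      (tendsto_trigPolynomial_fourier f).comp hS, fun j => (h1 j).2.2.comp hS⟩

theorem exists_subseq_tendsto_ae {F : ℕ → L2} {f : L2} (h : Tendsto F atTop (𝓝 f)) :
    ∃ n : ℕ → ℕ, StrictMono n ∧ ∀ᵐ x, Tendsto (fun i => F (n i) x) atTop (𝓝 (f x)) :=
  (tendstoInMeasure_of_tendsto_Lp h).exists_seq_tendsto_ae

/-! ### The Sobolev embedding H² ⊂ L^∞ -/

/-- The weight `min(1, |k|^{-4})` of the Sobolev embedding `H² ⊂ L^∞` (up to equivalence). -/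
def embeddingWeight (k : Fin 2 → ℤ) : ℝ := (if k = 0 then 1 else 0) + ‖k‖ ^ (-4 : ℝ)

theorem embeddingWeight_nonneg (k : Fin 2 → ℤ) : 0 ≤ embeddingWeight k := by
  unfold embeddingWeight
  split_ifs <;> positivity

theorem summable_embeddingWeight : Summable embeddingWeight := by
  refine Summable.add ?_ (EisensteinSeries.summable_one_div_norm_rpow (by norm_num))
  exact summable_of_ne_finset_zero (s := {0}) fun k hk => if_neg (by simpa using hk)

theorem one_le_embeddingWeight_mul {s : ℝ} (hs : 2 ≤ s) (k : Fin 2 → ℤ) :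
    1 ≤ embeddingWeight k * (1 + freqNorm k ^ s) ^ 2 := by
  have hf := Real.rpow_nonneg (freqNorm_nonneg k) s
  by_cases hk : k = 0
  · have h1 : 1 ≤ embeddingWeight k := by
      rw [embeddingWeight, if_pos hk]
      have := Real.rpow_nonneg (norm_nonneg k) (-4)
      linarith
    nlinarith
  · have hk1 : 1 ≤ ‖k‖ := by
      obtain ⟨j, hj⟩ := Function.ne_iff.1 hk
      refine le_trans ?_ (norm_le_pi_norm k j)
      rw [Int.norm_eq_abs]
      exact_mod_cast Int.one_le_abs hj
    have h2 : ‖k‖ ^ 2 ≤ freqNorm k ^ s := by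
      rw [← Real.rpow_two]
      exact (Real.rpow_le_rpow_of_exponent_le hk1 hs).trans
        (Real.rpow_le_rpow (norm_nonneg k) (norm_le_freqNorm k) (by linarith))
    have h3 : embeddingWeight k = (‖k‖ ^ 4)⁻¹ := by
      rw [embeddingWeight, if_neg hk, zero_add, Real.rpow_neg (norm_nonneg k)]
      norm_cast
    rw [h3, inv_mul_eq_div, one_le_div (by positivity)]
    nlinarith [sq_nonneg ‖k‖]

/-- The constant of the Sobolev embedding `H² ⊂ L^∞`. -/
def embeddingConstant : ℝ := Real.sqrt (∑' k, embeddingWeight k)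

theorem embeddingConstant_nonneg : 0 ≤ embeddingConstant := Real.sqrt_nonneg _

/-- Cauchy–Schwarz with the summable weight bounds ∑ |f̂(k)|, hence all partial Fourier sums
uniformly. A subsequence of these converges to f almost everywhere and transmits the bound. -/
theorem ae_abs_le_sobolevNorm {s : ℝ} (hs : 2 ≤ s) {f : L2} (h : sobolevNorm s f < ⊤) :
    ∀ᵐ x, |f x| ≤ embeddingConstant * (sobolevNorm s f).toReal := by
  have hsum := hasSum_sobolevNorm h
  have hbound : ∀ S : Finset (Fin 2 → ℤ),
      ∑ k ∈ S, ‖fourierCoefficient f k‖ ≤ embeddingConstant * (sobolevNorm s f).toReal := by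
    intro S
    refine le_of_sq_le_sq ?_ (mul_nonneg embeddingConstant_nonneg ENNReal.toReal_nonneg)
    rw [mul_pow, embeddingConstant, Real.sq_sqrt (tsum_nonneg embeddingWeight_nonneg)]
    refine (Finset.sum_sq_le_sum_mul_sum_of_sq_le_mul S (f := embeddingWeight)
      (g := fun k => (1 + freqNorm k ^ s) ^ 2 * ‖fourierCoefficient f k‖ ^ 2)
      (fun k _ => embeddingWeight_nonneg k) (fun k _ => by positivity) fun k _ => ?_).trans ?_
    · rw [← mul_assoc]
      exact le_mul_of_one_le_left (sq_nonneg _) (one_le_embeddingWeight_mul hs k)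
    · refine mul_le_mul (summable_embeddingWeight.sum_le_tsum S
        fun k _ => embeddingWeight_nonneg k) ?_ (Finset.sum_nonneg fun k _ => by positivity)
        (tsum_nonneg embeddingWeight_nonneg)
      exact sum_le_hasSum S (fun k _ => by positivity) hsum
  obtain ⟨S, hS⟩ := exists_seq_tendsto (atTop : Filter (Finset (Fin 2 → ℤ)))
  obtain ⟨n, -, hn⟩ := exists_subseq_tendsto_ae ((tendsto_trigPolynomial_fourier f).comp hS)
  have hae : ∀ᵐ x, ∀ i, testL2 (trigPolynomial (fourierCoefficient f) (S (n i))) x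
      = (trigPolynomial (fourierCoefficient f) (S (n i)) : Torus → ℝ) x :=
    ae_all_iff.2 fun i => coeFn_testL2 _
  filter_upwards [hn, hae] with x h1 h2
  refine le_of_tendsto h1.abs (Eventually.of_forall fun i => ?_)
  simp only [Function.comp_apply, h2]
  exact (abs_trigPolynomial_le _ _ x).trans (hbound _)

/-! ### Cutoff, truncation and excess functions of one real variable -/

/-- A smooth even cutoff which vanishes exactly on `[-M, M]` and increases with `|z|`. -/
def cutoff (M z : ℝ) : ℝ := Real.smoothTransition (z ^ 2 - M ^ 2)

/-- A smooth odd truncation function with derivative `cutoff M`. -/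
def truncation (M z : ℝ) : ℝ := ∫ x in (0 : ℝ)..z, cutoff M x

/-- A convex function with derivative `truncation M`, which vanishes exactly on `[-M, M]`. -/
def excess (M z : ℝ) : ℝ := ∫ x in (0 : ℝ)..z, truncation M x

section Truncation

variable (M : ℝ)

theorem contDiff_cutoff : ContDiff ℝ ∞ (cutoff M) :=
  Real.smoothTransition.contDiff.comp ((contDiff_id.pow 2).sub contDiff_const)

theorem continuous_cutoff : Continuous (cutoff M) := (contDiff_cutoff M).continuous

theorem cutoff_nonneg (z : ℝ) : 0 ≤ cutoff M z := Real.smoothTransition.nonneg _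

theorem cutoff_le_one (z : ℝ) : cutoff M z ≤ 1 := Real.smoothTransition.le_one _

theorem cutoff_neg (z : ℝ) : cutoff M (-z) = cutoff M z := by simp [cutoff]

theorem cutoff_mono {x z : ℝ} (hx : 0 ≤ x) (hxz : x ≤ z) : cutoff M x ≤ cutoff M z :=
  Real.smoothTransition.monotone (sub_le_sub_right (pow_le_pow_left₀ hx hxz 2) _)

theorem hasDerivAt_truncation (z : ℝ) : HasDerivAt (truncation M) (cutoff M z) z :=
  intervalIntegral.integral_hasDerivAt_right ((continuous_cutoff M).intervalIntegrable _ _)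
    ((continuous_cutoff M).stronglyMeasurableAtFilter _ _) (continuous_cutoff M).continuousAt

theorem differentiable_truncation : Differentiable ℝ (truncation M) := fun z =>
  (hasDerivAt_truncation M z).differentiableAt

theorem continuous_truncation : Continuous (truncation M) :=
  (differentiable_truncation M).continuous

theorem contDiff_truncation : ContDiff ℝ ∞ (truncation M) := by
  rw [contDiff_infty_iff_deriv]
  refine ⟨differentiable_truncation M, ?_⟩
  rw [funext fun z => (hasDerivAt_truncation M z).deriv]
  exact contDiff_cutoff M

theorem truncation_zero : truncation M 0 = 0 := intervalIntegral.integral_same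

theorem truncation_neg (z : ℝ) : truncation M (-z) = -truncation M z := by
  have h := intervalIntegral.integral_comp_neg (a := 0) (b := z) (cutoff M)
  simp only [cutoff_neg, neg_zero] at h
  rw [truncation, truncation, h, intervalIntegral.integral_symm]

theorem monotone_truncation : Monotone (truncation M) :=
  monotone_of_deriv_nonneg (differentiable_truncation M) fun z => by
    rw [(hasDerivAt_truncation M z).deriv]
    exact cutoff_nonneg M z

theorem lipschitzWith_truncation : LipschitzWith 1 (truncation M) :=
  lipschitzWith_of_nnnorm_deriv_le (differentiable_truncation M) fun z => by
    rw [(hasDerivAt_truncation M z).deriv, ← NNReal.coe_le_coe, coe_nnnorm, Real.norm_eq_abs,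
      abs_of_nonneg (cutoff_nonneg M z)]
    exact cutoff_le_one M z

theorem abs_truncation_le (z : ℝ) : |truncation M z| ≤ |z| := by
  have h := (lipschitzWith_truncation M).dist_le_mul z 0
  simpa [Real.dist_eq, truncation_zero] using h

theorem hasDerivAt_excess (z : ℝ) : HasDerivAt (excess M) (truncation M z) z :=
  intervalIntegral.integral_hasDerivAt_right ((continuous_truncation M).intervalIntegrable _ _)
    ((continuous_truncation M).stronglyMeasurableAtFilter _ _) (continuous_truncation M).continuousAt

theorem continuous_excess : Continuous (excess M) :=
  continuous_iff_continuousAt.2 fun z => (hasDerivAt_excess M z).continuousAt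

theorem excess_zero : excess M 0 = 0 := intervalIntegral.integral_same

theorem excess_neg (z : ℝ) : excess M (-z) = excess M z := by
  have h := intervalIntegral.integral_comp_neg (a := 0) (b := z) (truncation M)
  simp only [truncation_neg, neg_zero, intervalIntegral.integral_neg] at h
  rw [excess, excess, intervalIntegral.integral_symm, ← h, neg_neg]

/-- Convexity of the excess, whose derivative is monotone. The slope is taken at a, the later time
in the application; this inequality stands in for the chain rule in time. -/
theorem excess_sub_le (a b : ℝ) : excess M a - excess M b ≤ truncation M a * (a - b) := by
  have hi : ∀ a b, IntervalIntegrable (truncation M) volume a b := fun a b =>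
    (continuous_truncation M).intervalIntegrable a b
  rw [excess, excess, intervalIntegral.integral_interval_sub_left (hi _ _) (hi _ _)]
  rcases le_total b a with h | h
  · have := intervalIntegral.integral_mono_on h (hi b a)
      (intervalIntegrable_const (c := truncation M a)) fun x hx => monotone_truncation M hx.2
    rw [intervalIntegral.integral_const, smul_eq_mul] at this
    linarith
  · have := intervalIntegral.integral_mono_on h (intervalIntegrable_const (c := truncation M a))
      (hi a b) fun x hx => monotone_truncation M hx.1
    rw [intervalIntegral.integral_const, smul_eq_mul] at this
    rw [intervalIntegral.integral_symm]
    linarith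

theorem excess_nonneg (z : ℝ) : 0 ≤ excess M z := by
  have := excess_sub_le M 0 z
  rw [excess_zero, truncation_zero] at this
  linarith

theorem abs_excess_sub_le (a b : ℝ) :
    |excess M a - excess M b| ≤ (|a| + |b|) * |a - b| := by
  have key : ∀ a b, excess M a - excess M b ≤ (|a| + |b|) * |a - b| := fun a b => by
    refine (excess_sub_le M a b).trans ((le_abs_self _).trans ?_)
    rw [abs_mul]
    have := abs_truncation_le M a
    have := abs_nonneg b
    gcongr
    linarith
  refine abs_le.2 ⟨?_, key a b⟩
  have := key b a
  rw [abs_sub_comm b a, add_comm |b|] at this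
  linarith

theorem excess_le_sq (z : ℝ) : excess M z ≤ z ^ 2 := by
  have := abs_excess_sub_le M z 0
  rw [excess_zero, sub_zero, sub_zero, abs_zero, add_zero, abs_mul_abs_self, ← sq] at this
  exact (le_abs_self _).trans this

/-- For z ≥ 0 the function 2c(z)E(x) - τ(x)² vanishes at x = 0 and has derivative 2τ(x)(c(z) -
c(x)), nonnegative on [0, z] because c increases there; parity covers z < 0. This is the inequality
that lets the dissipation absorb the drift. -/
theorem sq_truncation_le (z : ℝ) : truncation M z ^ 2 ≤ 2 * cutoff M z * excess M z := by
  have key : ∀ z, 0 ≤ z → truncation M z ^ 2 ≤ 2 * cutoff M z * excess M z := fun z hz => by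
    have hd : ∀ x, HasDerivAt (fun x => 2 * cutoff M z * excess M x - truncation M x ^ 2)
        (2 * cutoff M z * truncation M x - 2 * truncation M x * cutoff M x) x := fun x => by
      simpa using ((hasDerivAt_excess M x).const_mul (2 * cutoff M z)).fun_sub
        ((hasDerivAt_truncation M x).fun_pow 2)
    have hmono : MonotoneOn (fun x => 2 * cutoff M z * excess M x - truncation M x ^ 2)
        (Icc 0 z) := by
      refine monotoneOn_of_deriv_nonneg (convex_Icc 0 z)
        (fun x _ => (hd x).continuousAt.continuousWithinAt)
        (fun x _ => (hd x).differentiableAt.differentiableWithinAt) fun x hx => ?_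
      rw [(hd x).deriv]
      rw [interior_Icc] at hx
      have h1 := cutoff_mono M hx.1.le hx.2.le
      have h2 : 0 ≤ truncation M x := truncation_zero M ▸ monotone_truncation M hx.1.le
      nlinarith
    have := hmono (left_mem_Icc.2 hz) (right_mem_Icc.2 hz) hz
    simp only [excess_zero, truncation_zero] at this
    linarith
  rcases le_total 0 z with h | h
  · exact key z h
  · have := key (-z) (neg_nonneg.2 h)
    rwa [truncation_neg, cutoff_neg, excess_neg, neg_sq] at this

variable {M}

theorem excess_eq_zero {z : ℝ} (hz : |z| ≤ M) : excess M z = 0 := by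
  have hcut : ∀ x, |x| ≤ M → cutoff M x = 0 := fun x hx =>
    Real.smoothTransition.zero_of_nonpos (sub_nonpos.2 (sq_le_sq' (abs_le.1 hx).1 (abs_le.1 hx).2))
  have hle : ∀ {x y : ℝ}, x ∈ uIcc 0 y → |x| ≤ |y| := fun {x y} hx => by
    simpa using abs_sub_left_of_mem_uIcc hx
  have htr : ∀ y, |y| ≤ M → truncation M y = 0 := fun y hy => by
    rw [truncation, intervalIntegral.integral_congr (g := fun _ => 0)
      fun x hx => hcut x ((hle hx).trans hy)]
    simp
  rw [excess, intervalIntegral.integral_congr (g := fun _ => 0)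
    fun x hx => htr x ((hle hx).trans hz)]
  simp

theorem abs_le_of_excess_nonpos (hM : 0 ≤ M) {z : ℝ} (hz : excess M z ≤ 0) : |z| ≤ M := by
  by_contra! hlt
  have key : ∀ z, M < z → 0 < excess M z := fun z hz => by
    have hz0 : 0 < z := hM.trans_lt hz
    have hc : 0 < cutoff M z := Real.smoothTransition.pos_of_pos
      (sub_pos.2 (pow_lt_pow_left₀ hz hM two_ne_zero))
    have ht : 0 < truncation M z :=
      intervalIntegral.integral_pos hz0 (continuous_cutoff M).continuousOn
        (fun x _ => cutoff_nonneg M x) ⟨z, right_mem_Icc.2 hz0.le, hc⟩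
    exact intervalIntegral.integral_pos hz0 (continuous_truncation M).continuousOn
        (fun x hx => truncation_zero M ▸ monotone_truncation M hx.1.le)
        ⟨z, right_mem_Icc.2 hz0.le, ht⟩
  have h : 0 < excess M |z| := key _ hlt
  rcases abs_choice z with h1 | h1 <;> rw [h1] at h
  · linarith
  · rw [excess_neg] at h
    linarith

end Truncation

/-! ### Truncation and total excess on L² -/

/-- The map `f ↦ truncation M ∘ f` on `L²`. -/
def truncationL2 (M : ℝ) (f : L2) : L2 :=
  (lipschitzWith_truncation M).compLp (truncation_zero M) f

theorem coeFn_truncationL2 (M : ℝ) (f : L2) :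
    truncationL2 M f =ᵐ[volume] fun x => truncation M (f x) :=
  (lipschitzWith_truncation M).coeFn_compLp (truncation_zero M) f

theorem norm_truncationL2_sub_le (M : ℝ) (f g : L2) :
    ‖truncationL2 M f - truncationL2 M g‖ ≤ ‖f - g‖ := by
  have h := (lipschitzWith_truncation M).norm_compLp_sub_le (truncation_zero M) f g
  rwa [NNReal.coe_one, one_mul] at h

theorem norm_truncationL2_le (M : ℝ) (f : L2) : ‖truncationL2 M f‖ ≤ ‖f‖ := by
  have h := (lipschitzWith_truncation M).norm_compLp_le (truncation_zero M) f
  rwa [NNReal.coe_one, one_mul] at h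

theorem continuous_truncationL2 (M : ℝ) : Continuous (truncationL2 M) :=
  (lipschitzWith_truncation M).continuous_compLp (truncation_zero M)

theorem integrable_mul (f g : L2) : Integrable fun x => f x * g x :=
  (Lp.memLp f).integrable_mul (Lp.memLp g)

theorem integral_abs_mul_abs_le (f g : L2) : ∫ x, |f x| * |g x| ≤ ‖f‖ * ‖g‖ := by
  have h : ∫ x, |f x| * |g x| = pairing (|f| : L2) (|g| : L2) :=
    pairing_congr (Lp.coeFn_abs f).symm (Lp.coeFn_abs g).symm
  rw [h, pairing_eq_inner]
  refine (real_inner_le_norm _ _).trans ?_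
  rw [norm_abs_eq_norm, norm_abs_eq_norm]

theorem integrable_excess (M : ℝ) (f : L2) : Integrable fun x => excess M (f x) := by
  refine (Lp.memLp f).integrable_sq.mono'
    ((continuous_excess M).comp_aestronglyMeasurable (Lp.aestronglyMeasurable f))
    (Eventually.of_forall fun x => ?_)
  rw [Real.norm_eq_abs, abs_of_nonneg (excess_nonneg M _)]
  exact excess_le_sq M _

/-- The total excess `∫ excess M (f x) dx` of an `L²` function above the level `M`. -/
def totalExcess (M : ℝ) (f : L2) : ℝ := ∫ x, excess M (f x)

theorem totalExcess_nonneg (M : ℝ) (f : L2) : 0 ≤ totalExcess M f :=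
  integral_nonneg fun _ => excess_nonneg M _

theorem totalExcess_sub_le (M : ℝ) (f g : L2) :
    totalExcess M f - totalExcess M g ≤ inner ℝ (truncationL2 M f) (f - g) := by
  rw [totalExcess, totalExcess, ← integral_sub (integrable_excess M f) (integrable_excess M g),
    ← pairing_eq_inner]
  refine integral_mono_ae ((integrable_excess M f).sub (integrable_excess M g))
    (integrable_mul _ _) ?_
  filter_upwards [coeFn_truncationL2 M f, Lp.coeFn_sub f g] with x h1 h2
  rw [h1, h2]
  exact excess_sub_le M _ _

/-- The convexity inequality, used in both directions with ‖τ(f)‖ ≤ ‖f‖, makes the total excess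
locally Lipschitz. -/
theorem continuous_totalExcess (M : ℝ) : Continuous (totalExcess M) := by
  have key : ∀ f g : L2, totalExcess M f - totalExcess M g ≤ ‖f‖ * ‖f - g‖ := fun f g => by
    refine (totalExcess_sub_le M f g).trans ((real_inner_le_norm _ _).trans ?_)
    gcongr
    exact norm_truncationL2_le M f
  rw [continuous_iff_continuousAt]
  intro f
  rw [ContinuousAt, tendsto_iff_norm_sub_tendsto_zero]
  have hlim : Tendsto (fun g : L2 => (‖g‖ + ‖f‖) * ‖g - f‖) (𝓝 f) (𝓝 0) := by
    have : Continuous fun g : L2 => (‖g‖ + ‖f‖) * ‖g - f‖ := by fun_prop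
    simpa using this.tendsto f
  refine squeeze_zero (fun g => norm_nonneg _) (fun g => ?_) hlim
  rw [Real.norm_eq_abs, abs_le]
  have h1 := key f g
  have h2 := key g f
  rw [norm_sub_rev f g] at h1
  have h3 := mul_nonneg (norm_nonneg f) (norm_nonneg (g - f))
  have h4 := mul_nonneg (norm_nonneg g) (norm_nonneg (g - f))
  constructor <;> nlinarith

/-! ### Dissipation of the total excess -/

/-- Integration by parts against a nonlinear function of `f ∈ H²`:
`∫ truncation M f · ∂ⱼ∂ⱼf = -∫ cutoff M f · (∂ⱼf)²`. -/
theorem integral_truncation_mul_eq (M : ℝ) {j : Fin 2} {f p q : L2} (hpq : IsWeakPartial j p q)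
    {φ : ℕ → testFunctions} (hf : Tendsto (fun n => testL2 (φ n)) atTop (𝓝 f))
    (hp : Tendsto (fun n => testL2 (testPartial j (φ n))) atTop (𝓝 p)) :
    ∫ x, truncation M (f x) * q x = -∫ x, cutoff M (f x) * p x ^ 2 := by
  obtain ⟨n, hn, hae⟩ := exists_subseq_tendsto_ae hf
  -- For smooth φᵢ the composite τ(φᵢ) is an admissible test function in the definition of q = ∂ⱼp.
  have hweak : ∀ i, ∫ x, p x * (cutoff M (testL2 (φ i) x) * testL2 (testPartial j (φ i)) x)
      = -inner ℝ q (truncationL2 M (testL2 (φ i))) := fun i => by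
    have h1 := hpq _ (comp_mem_testFunctions (contDiff_truncation M) (φ i).2)
    rw [← pairing_eq_inner]
    refine Eq.trans ?_ (h1.trans (congrArg Neg.neg ?_))
    · refine pairing_congr ae_eq_rfl ?_
      filter_upwards [coeFn_testL2 (φ i), coeFn_testL2 (testPartial j (φ i))] with x h2 h3
      rw [h2, h3, classicalPartial_comp (hasDerivAt_truncation M) (φ i).2]
      rfl
    · refine pairing_congr ae_eq_rfl ?_
      filter_upwards [coeFn_testL2 (φ i), coeFn_truncationL2 M (testL2 (φ i))] with x h2 h3
      rw [h3, h2]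
  have hR : Tendsto (fun i => -inner ℝ q (truncationL2 M (testL2 (φ i)))) atTop
      (𝓝 (-∫ x, truncation M (f x) * q x)) := by
    have h1 := (tendsto_const_nhds (x := q)).inner (𝕜 := ℝ)
      (((continuous_truncationL2 M).tendsto f).comp hf)
    rw [← pairing_eq_inner, pairing] at h1
    have h2 : ∫ x, q x * truncationL2 M f x = ∫ x, truncation M (f x) * q x := by
      refine integral_congr_ae ?_
      filter_upwards [coeFn_truncationL2 M f] with x hx
      rw [hx, mul_comm]
    rw [h2] at h1
    exact h1.neg
  have hcm : ∀ g : L2, AEStronglyMeasurable (fun x => cutoff M (g x)) volume := fun g =>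
    (continuous_cutoff M).comp_aestronglyMeasurable (Lp.aestronglyMeasurable g)
  have hb : ∀ z, ‖cutoff M z‖ ≤ 1 := fun z => by
    rw [Real.norm_eq_abs, abs_of_nonneg (cutoff_nonneg M z)]
    exact cutoff_le_one M z
  have hint : ∀ g r s : L2, Integrable fun x => cutoff M (g x) * (r x * s x) := fun g r s =>
    (integrable_mul r s).bdd_mul (hcm g) (Eventually.of_forall fun x => hb _)
  -- The product c(φᵢ) p ∂ⱼφᵢ is split as c(φᵢ) p² + c(φᵢ) p (∂ⱼφᵢ - p). The first part converges by
  -- dominated convergence along the a.e. convergent subsequence, the second tends to 0 by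
  -- Cauchy–Schwarz, as 0 ≤ c ≤ 1.
  have hL1 : Tendsto (fun i => ∫ x, cutoff M (testL2 (φ (n i)) x) * (p x * p x)) atTop
      (𝓝 (∫ x, cutoff M (f x) * (p x * p x))) := by
    refine tendsto_integral_of_dominated_convergence (fun x => |p x * p x|)
      (fun i => (hint _ p p).aestronglyMeasurable) (integrable_mul p p).abs
      (fun i => Eventually.of_forall fun x => ?_) ?_
    · rw [norm_mul]
      exact mul_le_of_le_one_left (norm_nonneg _) (hb _)
    · filter_upwards [hae] with x hx
      exact (((continuous_cutoff M).tendsto _).comp hx).mul_const _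
  have hL2 : Tendsto (fun i => ∫ x, cutoff M (testL2 (φ (n i)) x)
      * (p x * (testL2 (testPartial j (φ (n i))) - p : L2) x)) atTop (𝓝 0) := by
    have h0 : Tendsto (fun i => ‖p‖ * ‖testL2 (testPartial j (φ (n i))) - p‖) atTop (𝓝 0) := by
      have := (tendsto_iff_norm_sub_tendsto_zero.1 (hp.comp hn.tendsto_atTop)).const_mul ‖p‖
      simpa using this
    refine squeeze_zero_norm (fun i => ?_) h0
    refine (norm_integral_le_integral_norm _).trans
      (le_trans (integral_mono_of_nonneg (Eventually.of_forall fun x => norm_nonneg _) ?_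
        (Eventually.of_forall fun x => ?_)) (integral_abs_mul_abs_le p _))
    · simpa only [abs_mul] using (integrable_mul p (testL2 (testPartial j (φ (n i))) - p)).abs
    · simp only
      rw [norm_mul, norm_mul]
      exact mul_le_of_le_one_left (by positivity) (hb _)
  have hsplit : ∀ i, ∫ x, p x * (cutoff M (testL2 (φ i) x) * testL2 (testPartial j (φ i)) x)
      = (∫ x, cutoff M (testL2 (φ i) x) * (p x * p x))
        + ∫ x, cutoff M (testL2 (φ i) x) * (p x * (testL2 (testPartial j (φ i)) - p : L2) x) :=
    fun i => by
    rw [← integral_add (hint _ p p) (hint _ p _)]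
    refine integral_congr_ae ?_
    filter_upwards [Lp.coeFn_sub (testL2 (testPartial j (φ i))) p] with x hx
    rw [hx, Pi.sub_apply]
    ring
  have hlim := hL1.add hL2
  simp only [← hsplit, add_zero] at hlim
  simp only [hweak] at hlim
  have := tendsto_nhds_unique (hR.comp hn.tendsto_atTop) hlim
  simp only [sq]
  linarith

/-- The right-hand side `νΔf - (v·∇)f` of the equation of the first component, in `L²`. -/
theorem exists_rhs {ν K : ℝ} (hν : 0 < ν) (hK : 0 ≤ K) {f : L2} (h : sobolevNorm 2 f < ⊤)
    {v : Fin 2 → L2} (hv : ∀ j, ∀ᵐ x, |v j x| ≤ K) :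
    ∃ g : L2, (g =ᵐ[volume] fun x => ∑ j, (ν * weakPartial j (weakPartial j f) x
        - v j x * weakPartial j f x))
      ∧ ‖g‖ ≤ 4 * Real.pi * (ν + K) * (sobolevNorm 2 f).toReal
      ∧ ∀ φ : testFunctions,
        ν * gradPairing f φ + transportPairing v f φ = -inner ℝ g (testL2 φ) := by
  obtain ⟨hw, -⟩ := weakPartial_of_sobolevNorm_two h
  have hprod : ∀ j, ∀ᵐ x, ‖v j x * weakPartial j f x‖ ≤ K * ‖weakPartial j f x‖ := fun j => by
    filter_upwards [hv j] with x hx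
    rw [norm_mul]
    exact mul_le_mul_of_nonneg_right hx (norm_nonneg _)
  have hmem : ∀ j, MemLp (fun x => v j x * weakPartial j f x) 2 volume := fun j =>
    (Lp.memLp (weakPartial j f)).of_le_mul
      ((Lp.aestronglyMeasurable _).mul (Lp.aestronglyMeasurable _)) (hprod j)
  set r : Fin 2 → L2 := fun j => (hmem j).toLp _ with hr
  have hrc : ∀ j, r j =ᵐ[volume] fun x => v j x * weakPartial j f x := fun j => (hmem j).coeFn_toLp
  have hrn : ∀ j, ‖r j‖ ≤ K * ‖weakPartial j f‖ := fun j => by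
    refine Lp.norm_le_mul_norm_of_ae_le_mul ?_
    filter_upwards [hrc j, hprod j] with x h1 h2
    rwa [h1]
  set d : Fin 2 → L2 := fun j => ν • weakPartial j (weakPartial j f) - r j with hd
  have hdc : ∀ j, d j =ᵐ[volume] fun x => ν * weakPartial j (weakPartial j f) x
        - v j x * weakPartial j f x := fun j => by
    filter_upwards [Lp.coeFn_sub (ν • weakPartial j (weakPartial j f)) (r j),
      Lp.coeFn_smul ν (weakPartial j (weakPartial j f)), hrc j] with x h1 h2 h3
    rw [hd, h1, Pi.sub_apply, h2, h3]
    rfl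
  have hdn : ∀ j, ‖d j‖ ≤ 2 * Real.pi * (ν + K) * (sobolevNorm 2 f).toReal := fun j => by
    refine (norm_sub_le _ _).trans ?_
    rw [norm_smul, Real.norm_of_nonneg hν.le]
    have h1 := mul_le_mul_of_nonneg_left (hw j).2.2.2 hν.le
    have h2 := (hrn j).trans (mul_le_mul_of_nonneg_left (hw j).2.2.1 hK)
    linarith
  refine ⟨d 0 + d 1, ?_, ?_, fun φ => ?_⟩
  · filter_upwards [Lp.coeFn_add (d 0) (d 1), hdc 0, hdc 1] with x h1 h2 h3
    rw [h1, Pi.add_apply, h2, h3, Fin.sum_univ_two]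
  · have := norm_add_le (d 0) (d 1)
    have := hdn 0
    have := hdn 1
    linarith
  · have hg : gradPairing f φ
        = -∑ j, inner ℝ (weakPartial j (weakPartial j f)) (testL2 φ) := by
      rw [gradPairing, ← Finset.sum_neg_distrib]
      refine Finset.sum_congr rfl fun j _ => ?_
      rw [(hw j).2.1 φ φ.2, pairing_test]
    have ht : transportPairing v f φ = ∑ j, inner ℝ (r j) (testL2 φ) := by
      rw [Fin.sum_univ_two, ← inner_add_left, ← pairing_test]
      refine pairing_congr ?_ ae_eq_rfl
      filter_upwards [Lp.coeFn_add (r 0) (r 1), hrc 0, hrc 1] with x h1 h2 h3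
      rw [h1, Pi.add_apply, h2, h3, Fin.sum_univ_two]
    rw [hg, ht]
    simp only [hd, Fin.sum_univ_two, inner_add_left, inner_sub_left, inner_smul_left]
    simp only [conj_trivial]
    ring

/-- The dissipation of the total excess by `νΔf - (v·∇)f`. -/
theorem inner_truncationL2_rhs_le {ν K : ℝ} (hν : 0 < ν) (M : ℝ) {f : L2}
    (h : sobolevNorm 2 f < ⊤) {v : Fin 2 → L2} (hv : ∀ j, ∀ᵐ x, |v j x| ≤ K) {g : L2}
    (hg : g =ᵐ[volume] fun x => ∑ j, (ν * weakPartial j (weakPartial j f) x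
        - v j x * weakPartial j f x)) :
    inner ℝ (truncationL2 M f) g ≤ K ^ 2 / ν * totalExcess M f := by
  obtain ⟨hw, φ, hφ, hφp⟩ := weakPartial_of_sobolevNorm_two h
  have hibp := fun j => integral_truncation_mul_eq M (hw j).2.1 hφ (hφp j)
  have hiq : ∀ j, Integrable fun x => truncation M (f x) * weakPartial j (weakPartial j f) x :=
    fun j => (integrable_mul (truncationL2 M f) (weakPartial j (weakPartial j f))).congr (by
      filter_upwards [coeFn_truncationL2 M f] with x hx
      rw [hx])
  have hip : ∀ j, Integrable fun x => cutoff M (f x) * weakPartial j f x ^ 2 := fun j => by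
    refine (Lp.memLp (weakPartial j f)).integrable_sq.bdd_mul (c := 1)
      ((continuous_cutoff M).comp_aestronglyMeasurable (Lp.aestronglyMeasurable f))
      (Eventually.of_forall fun x => ?_)
    rw [Real.norm_eq_abs, abs_of_nonneg (cutoff_nonneg M _)]
    exact cutoff_le_one M _
  have hiG := (integrable_excess M f).const_mul (K ^ 2 / ν)
  -- Integration by parts is recorded as a vanishing integral. Adding these zeros to the right-hand
  -- side reduces the claim to a pointwise inequality.
  have hzero : ∀ j, ∫ x, (ν * (truncation M (f x) * weakPartial j (weakPartial j f) x)
      + ν * (cutoff M (f x) * weakPartial j f x ^ 2)) = 0 := fun j => by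
    rw [integral_add ((hiq j).const_mul ν) ((hip j).const_mul ν), integral_const_mul,
      integral_const_mul, hibp j]
    ring
  have hi0 : ∀ j, Integrable fun x =>
      ν * (truncation M (f x) * weakPartial j (weakPartial j f) x)
      + ν * (cutoff M (f x) * weakPartial j f x ^ 2) := fun j =>
    ((hiq j).const_mul ν).add ((hip j).const_mul ν)
  have hrhs : K ^ 2 / ν * totalExcess M f = ∫ x, (K ^ 2 / ν * excess M (f x)
      + ∑ j, (ν * (truncation M (f x) * weakPartial j (weakPartial j f) x)
        + ν * (cutoff M (f x) * weakPartial j f x ^ 2))) := by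
    rw [integral_add hiG (integrable_finsetSum _ fun j _ => hi0 j),
      integral_finsetSum _ fun j _ => hi0 j, Finset.sum_eq_zero fun j _ => hzero j, add_zero,
      integral_const_mul]
    rfl
  rw [hrhs, ← pairing_eq_inner]
  refine integral_mono_ae (integrable_mul _ _)
    (hiG.add (integrable_finsetSum _ fun j _ => hi0 j)) ?_
  filter_upwards [coeFn_truncationL2 M f, hg, hv 0, hv 1] with x h1 h2 h3 h4
  rw [h1, h2, Fin.sum_univ_two, Fin.sum_univ_two]
  -- Young's inequality: with A = K²E/(2ν) and B = νcp², the bound τ² ≤ 2cE gives (τap)² ≤ 4AB ≤ (A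
  -- + B)². The two directions together produce the constant K²/ν.
  have hpt : ∀ a p : ℝ, |a| ≤ K → -(truncation M (f x) * (a * p))
      ≤ K ^ 2 / (2 * ν) * excess M (f x) + ν * (cutoff M (f x) * p ^ 2) := by
    intro a p ha
    have hb := sq_truncation_le M (f x)
    have hE := excess_nonneg M (f x)
    have hc := cutoff_nonneg M (f x)
    have ha2 : a ^ 2 ≤ K ^ 2 := sq_le_sq' (by linarith [(abs_le.1 ha).1]) (abs_le.1 ha).2
    refine (neg_le_abs _).trans (abs_le_of_sq_le_sq ?_ (by positivity))
    have h5 : (truncation M (f x) * (a * p)) ^ 2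
        ≤ 2 * cutoff M (f x) * excess M (f x) * (K ^ 2 * p ^ 2) := by
      rw [mul_pow, mul_pow]
      gcongr
    have h6 : 2 * cutoff M (f x) * excess M (f x) * (K ^ 2 * p ^ 2)
        = 4 * (K ^ 2 / (2 * ν) * excess M (f x)) * (ν * (cutoff M (f x) * p ^ 2)) := by
      field_simp
      ring
    linarith [four_mul_le_sq_add (K ^ 2 / (2 * ν) * excess M (f x))
      (ν * (cutoff M (f x) * p ^ 2))]
  have e0 := hpt _ (weakPartial 0 f x) h3
  have e1 := hpt _ (weakPartial 1 f x) h4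
  have e2 : K ^ 2 / ν * excess M (f x) = 2 * (K ^ 2 / (2 * ν) * excess M (f x)) := by
    field_simp
  rw [e2]
  linarith

/-! ### A Gronwall principle -/

/-- A Gronwall principle: a continuous function which grows infinitesimally at most like a solution
of `dy = (y + ε) dQ`, for every `ε > 0`, stays nonpositive. -/
theorem nonpos_of_local_growth {T : ℝ} {y Q : ℝ → ℝ} (hy : ContinuousOn y (Icc 0 T))
    (hQ : ContinuousOn Q (Icc 0 T)) (hQ0 : Q 0 = 0) (hQm : MonotoneOn Q (Icc 0 T)) (h0 : y 0 ≤ 0)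
    (hstep : ∀ x ∈ Ico 0 T, ∀ ε > 0, ∀ᶠ t in 𝓝[>] x, y t - y x ≤ (y x + ε) * (Q t - Q x)) :
    ∀ t ∈ Icc 0 T, y t ≤ 0 := by
  -- The barrier ε(e^Q - 1) solves dy = (y + ε) dQ from 0. The set where y lies below it is closed,
  -- contains 0 and extends to the right of each of its points, hence is all of [0, T]; then ε → 0.
  have key : ∀ ε > 0, Icc 0 T ⊆ {t | y t ≤ ε * (Real.exp (Q t) - 1)} := by
    intro ε hε
    refine IsClosed.Icc_subset_of_forall_mem_nhdsWithin ?_ ?_ ?_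
    · have hB : ContinuousOn (fun t => ε * (Real.exp (Q t) - 1)) (Icc 0 T) :=
        continuousOn_const.mul ((Real.continuous_exp.comp_continuousOn hQ).sub continuousOn_const)
      rw [inter_comm]
      exact isClosed_Icc.isClosed_le hy hB
    · simpa [hQ0] using h0
    · rintro x ⟨hx, hxI⟩
      filter_upwards [hstep x hxI ε hε, Ioo_mem_nhdsGT hxI.2] with t ht htI
      have hm := hQm ⟨hxI.1, hxI.2.le⟩ ⟨hxI.1.trans htI.1.le, htI.2.le⟩ htI.1.le
      have hx' : y x + ε ≤ ε * Real.exp (Q x) := by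
        have : y x ≤ ε * (Real.exp (Q x) - 1) := hx
        linarith
      have hexp : Real.exp (Q x) * (1 + (Q t - Q x)) ≤ Real.exp (Q t) := by
        have h1 := Real.add_one_le_exp (Q t - Q x)
        calc Real.exp (Q x) * (1 + (Q t - Q x)) ≤ Real.exp (Q x) * Real.exp (Q t - Q x) := by
              gcongr
              linarith
          _ = Real.exp (Q t) := by rw [← Real.exp_add]; congr 1; ring
      have h2 := mul_le_mul_of_nonneg_right hx' (sub_nonneg.2 hm)
      have h3 := mul_le_mul_of_nonneg_left hexp hε.le
      change y t ≤ ε * (Real.exp (Q t) - 1)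
      linarith
  intro t ht
  have hlim : Tendsto (fun ε : ℝ => ε * (Real.exp (Q t) - 1)) (𝓝[>] 0) (𝓝 0) := by
    have : Continuous fun ε : ℝ => ε * (Real.exp (Q t) - 1) := by fun_prop
    simpa using (this.tendsto 0).mono_left nhdsWithin_le_nhds
  exact ge_of_tendsto hlim (eventually_mem_nhdsWithin.mono fun ε hε => key ε hε ht)

/-! ### Smooth steps and the fundamental theorem of calculus for weak derivatives -/

/-- A smooth step from `0` to `1` on the interval `[s, s + 1 / (n + 1)]`. -/
def smoothStep (s : ℝ) (n : ℕ) (r : ℝ) : ℝ := Real.smoothTransition ((n + 1) * (r - s))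

theorem contDiff_smoothStep (s : ℝ) (n : ℕ) : ContDiff ℝ ∞ (smoothStep s n) :=
  Real.smoothTransition.contDiff.comp (contDiff_const.mul (contDiff_id.sub contDiff_const))

theorem smoothStep_eq_zero {s r : ℝ} (n : ℕ) (h : r ≤ s) : smoothStep s n r = 0 :=
  Real.smoothTransition.zero_of_nonpos
    (mul_nonpos_of_nonneg_of_nonpos (by positivity) (sub_nonpos.2 h))

theorem smoothStep_eq_one {s r : ℝ} {n : ℕ} (h : s + 1 / ((n : ℝ) + 1) ≤ r) :
    smoothStep s n r = 1 := by
  refine Real.smoothTransition.one_of_one_le ?_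
  have h1 : 1 / ((n : ℝ) + 1) ≤ r - s := by linarith
  rwa [div_le_iff₀' (by positivity)] at h1

theorem smoothStep_mem (s r : ℝ) (n : ℕ) : smoothStep s n r ∈ Icc (0 : ℝ) 1 :=
  ⟨Real.smoothTransition.nonneg _, Real.smoothTransition.le_one _⟩

theorem tendsto_smoothStep (s r : ℝ) :
    Tendsto (fun n => smoothStep s n r) atTop (𝓝 (if s < r then 1 else 0)) := by
  split_ifs with h
  · have h1 : ∀ᶠ n : ℕ in atTop, 1 / ((n : ℝ) + 1) < r - s :=
      tendsto_one_div_add_atTop_nhds_zero_nat.eventually_lt_const (sub_pos.2 h)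
    exact tendsto_const_nhds.congr' (h1.mono fun n hn => (smoothStep_eq_one (by linarith)).symm)
  · exact tendsto_const_nhds.congr fun n => (smoothStep_eq_zero n (not_lt.1 h)).symm

theorem deriv_smoothTransition_eq_zero {x : ℝ} (hx : x ∉ Icc (0 : ℝ) 1) :
    deriv Real.smoothTransition x = 0 := by
  rcases not_and_or.1 hx with h | h
  · have : Real.smoothTransition =ᶠ[𝓝 x] fun _ => 0 := by
      filter_upwards [Iio_mem_nhds (not_le.1 h)] with y hy
      exact Real.smoothTransition.zero_of_nonpos hy.le
    rw [this.deriv_eq, deriv_const]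
  · have : Real.smoothTransition =ᶠ[𝓝 x] fun _ => 1 := by
      filter_upwards [Ioi_mem_nhds (not_le.1 h)] with y hy
      exact Real.smoothTransition.one_of_one_le hy.le
    rw [this.deriv_eq, deriv_const]

theorem continuous_deriv_smoothTransition : Continuous (deriv Real.smoothTransition) :=
  (Real.smoothTransition.contDiff (n := 1)).continuous_deriv le_rfl

theorem hasCompactSupport_deriv_smoothTransition :
    HasCompactSupport (deriv Real.smoothTransition) :=
  HasCompactSupport.intro isCompact_Icc fun _ hx => deriv_smoothTransition_eq_zero hx

theorem integral_deriv_smoothTransition : ∫ x, deriv Real.smoothTransition x = 1 := by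
  have h1 : ∫ x, deriv Real.smoothTransition x
      = ∫ x in Icc (0 : ℝ) 1, deriv Real.smoothTransition x :=
    (setIntegral_eq_integral_of_forall_compl_eq_zero
      fun x hx => deriv_smoothTransition_eq_zero hx).symm
  rw [h1, integral_Icc_eq_integral_Ioc, ← intervalIntegral.integral_of_le zero_le_one,
    intervalIntegral.integral_deriv_eq_sub
      (fun x _ => (Real.smoothTransition.contDiff (n := 1)).differentiable (by simp) x)
      (continuous_deriv_smoothTransition.intervalIntegrable _ _)]
  simp

theorem deriv_smoothStep (s : ℝ) (n : ℕ) (r : ℝ) :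
    deriv (smoothStep s n) r = (n + 1) * deriv Real.smoothTransition ((n + 1) * (r - s)) := by
  have h1 : HasDerivAt (fun r : ℝ => ((n : ℝ) + 1) * (r - s)) ((n : ℝ) + 1) r := by
    simpa using ((hasDerivAt_id r).sub_const s).const_mul ((n : ℝ) + 1)
  have h2 := ((Real.smoothTransition.contDiff (n := 1)).differentiable (by simp)
    (((n : ℝ) + 1) * (r - s))).hasDerivAt
  rw [mul_comm]
  exact (h2.comp r h1).deriv

theorem integral_deriv_smoothStep_mul (s : ℝ) (n : ℕ) (h : ℝ → ℝ) :
    ∫ r, deriv (smoothStep s n) r * h r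
      = ∫ x, deriv Real.smoothTransition x * h (s + x / (n + 1)) := by
  have hn : (0 : ℝ) < (n : ℝ) + 1 := by positivity
  set F : ℝ → ℝ := fun x => deriv Real.smoothTransition x * h (s + x / (n + 1)) with hF
  have h1 : (fun r => deriv (smoothStep s n) r * h r)
      = fun r => ((n : ℝ) + 1) * F (((n : ℝ) + 1) * (r - s)) := by
    funext r
    rw [deriv_smoothStep, hF]
    simp only
    rw [mul_div_cancel_left₀ _ hn.ne', add_sub_cancel, mul_assoc]
  rw [h1, integral_const_mul, integral_sub_right_eq_self (fun r => F (((n : ℝ) + 1) * r)) s,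
    Measure.integral_comp_mul_left, abs_of_pos (inv_pos.2 hn), smul_eq_mul,
    mul_inv_cancel_left₀ hn.ne']

/-- The derivatives of the steps form an approximate identity concentrating at s from the right;
rescaling to a fixed profile of integral 1 allows dominated convergence. -/
theorem tendsto_integral_deriv_smoothStep_mul (s : ℝ) {h : ℝ → ℝ} (hc : Continuous h) {C : ℝ}
    (hC : ∀ r, |h r| ≤ C) :
    Tendsto (fun n => ∫ r, deriv (smoothStep s n) r * h r) atTop (𝓝 (h s)) := by
  simp only [integral_deriv_smoothStep_mul]
  have h1 : h s = ∫ x, deriv Real.smoothTransition x * h s := by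
    rw [integral_mul_const, integral_deriv_smoothTransition, one_mul]
  rw [h1]
  have hi : Integrable (deriv Real.smoothTransition) :=
    continuous_deriv_smoothTransition.integrable_of_hasCompactSupport
      hasCompactSupport_deriv_smoothTransition
  refine tendsto_integral_of_dominated_convergence
    (fun x => |deriv Real.smoothTransition x| * C) (fun n => ?_) (hi.abs.mul_const C)
    (fun n => Eventually.of_forall fun x => ?_) (Eventually.of_forall fun x => ?_)
  · exact (continuous_deriv_smoothTransition.mul (hc.comp (by fun_prop))).aestronglyMeasurable
  · rw [norm_mul]
    exact mul_le_mul_of_nonneg_left (hC _) (abs_nonneg _)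
  · have h2 : Tendsto (fun n : ℕ => s + x / ((n : ℝ) + 1)) atTop (𝓝 s) := by
      have := (tendsto_one_div_add_atTop_nhds_zero_nat (𝕜 := ℝ)).const_mul x
      simpa [mul_one_div, div_eq_mul_inv] using this.const_add s
    exact ((hc.tendsto s).comp h2).const_mul _

theorem tsupport_smoothStep_sub_subset {s t : ℝ} (n : ℕ) (hst : s ≤ t) :
    tsupport (fun r => smoothStep s n r - smoothStep t n r) ⊆ Icc s (t + 1 / ((n : ℝ) + 1)) := by
  refine closure_minimal (fun r hr => ?_) isClosed_Icc
  by_contra hout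
  refine hr ?_
  rcases not_and_or.1 hout with h | h
  · have h := not_le.1 h
    simp only
    rw [smoothStep_eq_zero n h.le, smoothStep_eq_zero n (h.le.trans hst), sub_zero]
  · have h := not_le.1 h
    simp only
    rw [smoothStep_eq_one (by linarith), smoothStep_eq_one h.le, sub_self]

/-- The fundamental theorem of calculus for a continuous function with an integrable weak
derivative. -/
theorem sub_eq_integral_of_weak_deriv {T : ℝ} (hT : 0 < T) {h d : ℝ → ℝ}
    (hh : ContinuousOn h (Icc 0 T)) (hd : IntegrableOn d (Icc 0 T))
    (hw : ∀ ψ : ℝ → ℝ, ContDiff ℝ ∞ ψ → HasCompactSupport ψ → tsupport ψ ⊆ Ioo 0 T →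
      ∫ t in Icc 0 T, deriv ψ t * h t = -∫ t in Icc 0 T, ψ t * d t) :
    ∀ s ∈ Icc 0 T, ∀ t ∈ Icc 0 T, h t - h s = ∫ r in s..t, d r := by
  have hii : ∀ s ∈ Icc 0 T, ∀ t ∈ Icc 0 T, IntervalIntegrable d volume s t := fun s hs t ht =>
    (hd.mono_set (ordConnected_Icc.uIcc_subset hs ht)).intervalIntegrable
  -- The constant extension beyond the endpoints is bounded and continuous on all of ℝ, as the
  -- approximate identity requires.
  set H : ℝ → ℝ := IccExtend hT.le ((Icc 0 T).domRestrict h) with hHdef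
  have hHc : Continuous H := hh.domRestrict.Icc_extend'
  have hHe : ∀ r ∈ Icc 0 T, H r = h r := fun r hr => IccExtend_of_mem hT.le _ hr
  obtain ⟨C, hC⟩ : ∃ C, ∀ r, |H r| ≤ C := by
    obtain ⟨C, hC⟩ := isCompact_Icc.exists_bound_of_continuousOn hh
    exact ⟨C, fun r => hC _ (projIcc 0 T hT.le r).2⟩
  have inner_case : ∀ s t, 0 < s → s ≤ t → t < T → h t - h s = ∫ r in s..t, d r := by
    intro s t hs hst htT
    -- Smooth approximations of the indicator of (s, t]. Their supports reach at most t + 1/(n + 1),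
    -- hence lie in (0, T) for large n.
    set ψ : ℕ → ℝ → ℝ := fun n r => smoothStep s n r - smoothStep t n r with hψ
    have hev : ∀ᶠ n : ℕ in atTop, 1 / ((n : ℝ) + 1) < T - t :=
      tendsto_one_div_add_atTop_nhds_zero_nat.eventually_lt_const (sub_pos.2 htT)
    have hsub : ∀ᶠ n : ℕ in atTop, tsupport (ψ n) ⊆ Ioo 0 T := by
      filter_upwards [hev] with n hn
      exact (tsupport_smoothStep_sub_subset n hst).trans (Icc_subset_Ioo hs (by linarith))
    have hsd : ∀ s n, Differentiable ℝ (smoothStep s n) := fun s n =>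
      (contDiff_smoothStep s n).differentiable (by simp)
    have hdψ : ∀ n r, deriv (ψ n) r = deriv (smoothStep s n) r - deriv (smoothStep t n) r :=
      fun n r => deriv_fun_sub (hsd s n r) (hsd t n r)
    have hint : ∀ s n, Integrable fun r => deriv (smoothStep s n) r * H r := fun s n => by
      refine Continuous.integrable_of_hasCompactSupport
        (((contDiff_smoothStep s n).continuous_deriv (by simp)).mul hHc)
        (HasCompactSupport.mul_right ?_)
      refine HasCompactSupport.intro (K := Icc s (s + 1 / ((n : ℝ) + 1))) isCompact_Icc
        fun r hr => ?_
      rw [deriv_smoothStep, deriv_smoothTransition_eq_zero, mul_zero]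
      intro hmem
      have hn : (0 : ℝ) < (n : ℝ) + 1 := by positivity
      refine hr ⟨?_, ?_⟩
      · have := nonneg_of_mul_nonneg_right hmem.1 hn
        linarith
      · have : r - s ≤ 1 / ((n : ℝ) + 1) := by
          rw [le_div_iff₀' hn]
          exact hmem.2
        linarith
    have hL : Tendsto (fun n => ∫ r, deriv (ψ n) r * H r) atTop (𝓝 (H s - H t)) := by
      refine ((tendsto_integral_deriv_smoothStep_mul s hHc hC).sub
        (tendsto_integral_deriv_smoothStep_mul t hHc hC)).congr fun n => ?_
      rw [← integral_sub (hint s n) (hint t n)]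
      simp only [hdψ, sub_mul]
    have hR : Tendsto (fun n => -∫ r in Icc 0 T, ψ n r * d r) atTop
        (𝓝 (-∫ r in Icc 0 T, ((if s < r then 1 else 0) - if t < r then 1 else 0) * d r)) := by
      refine (tendsto_integral_of_dominated_convergence (fun r => |d r|) (fun n => ?_) hd.abs
        (fun n => Eventually.of_forall fun r => ?_) (Eventually.of_forall fun r => ?_)).neg
      · exact (((contDiff_smoothStep s n).continuous.sub
          (contDiff_smoothStep t n).continuous).aestronglyMeasurable).mul hd.aestronglyMeasurable
      · rw [norm_mul]
        refine mul_le_of_le_one_left (norm_nonneg _) ?_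
        have h1 := smoothStep_mem s r n
        have h2 := smoothStep_mem t r n
        rw [Real.norm_eq_abs, abs_le]
        exact ⟨by linarith [h1.1, h2.2], by linarith [h1.2, h2.1]⟩
      · exact ((tendsto_smoothStep s r).sub (tendsto_smoothStep t r)).mul_const _
    have hLR : ∀ᶠ n in atTop, ∫ r, deriv (ψ n) r * H r = -∫ r in Icc 0 T, ψ n r * d r := by
      filter_upwards [hsub] with n hn
      have hcs : HasCompactSupport (ψ n) :=
        isCompact_Icc.of_isClosed_subset (isClosed_tsupport _) (tsupport_smoothStep_sub_subset n hst)
      rw [← hw (ψ n) ((contDiff_smoothStep s n).sub (contDiff_smoothStep t n)) hcs hn,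
        ← setIntegral_eq_integral_of_forall_compl_eq_zero (s := Icc 0 T)]
      · exact setIntegral_congr_fun measurableSet_Icc fun r hr => by simp only [hHe r hr]
      · intro r hr
        have : deriv (ψ n) r = 0 := by
          have h1 : r ∉ tsupport (deriv (ψ n)) := fun hmem =>
            hr (Ioo_subset_Icc_self (hn (tsupport_deriv_subset hmem)))
          exact image_eq_zero_of_notMem_tsupport h1
        rw [this, zero_mul]
    have heq := tendsto_nhds_unique (hL.congr' hLR) hR
    rw [hHe s ⟨hs.le, hst.trans htT.le⟩, hHe t ⟨hs.le.trans hst, htT.le⟩] at heq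
    have hind : (fun r => ((if s < r then (1 : ℝ) else 0) - if t < r then 1 else 0) * d r)
        = (Ioc s t).indicator d := by
      funext r
      by_cases h1 : s < r <;> by_cases h2 : t < r
      · simp [h1, h2, not_le.2 h2]
      · simp [h1, h2, not_lt.1 h2]
      · exact absurd (hst.trans_lt h2) h1
      · simp [h1, h2]
    have hsubset : Ioc s t ⊆ Icc 0 T := fun r hr => ⟨hs.le.trans hr.1.le, hr.2.trans htT.le⟩
    rw [hind, setIntegral_indicator measurableSet_Ioc, inter_eq_right.2 hsubset,
      ← intervalIntegral.integral_of_le hst] at heq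
    linarith
  have h0 : (0 : ℝ) ∈ Icc 0 T := ⟨le_rfl, hT.le⟩
  have hm : T / 2 ∈ Ioo 0 T := ⟨by linarith, by linarith⟩
  have hmI := Ioo_subset_Icc_self hm
  have hcont : ContinuousOn (fun t => h t - ∫ r in (0 : ℝ)..t, d r) (Icc 0 T) := by
    refine hh.sub ?_
    have := intervalIntegral.continuousOn_primitive_interval (μ := volume) (f := d) (a := 0) (b := T)
      (by rwa [uIcc_of_le hT.le])
    rwa [uIcc_of_le hT.le] at this
  -- On the open interval h minus the primitive of d is constant; continuity carries this to the
  -- endpoints, which no test function sees.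
  have hconst : EqOn (fun t => h t - ∫ r in (0 : ℝ)..t, d r)
      (fun _ => h (T / 2) - ∫ r in (0 : ℝ)..(T / 2), d r) (Ioo 0 T) := by
    intro t ht
    have htI := Ioo_subset_Icc_self ht
    have hadd := intervalIntegral.integral_add_adjacent_intervals
      (hii 0 h0 (T / 2) hmI) (hii (T / 2) hmI t htI)
    simp only
    rcases le_total t (T / 2) with hle | hle
    · have := inner_case t (T / 2) ht.1 hle hm.2
      rw [intervalIntegral.integral_symm] at this
      linarith
    · have := inner_case (T / 2) t hm.1 hle ht.2
      linarith
  have hall := hconst.of_subset_closure hcont continuousOn_const Ioo_subset_Icc_self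
    (by rw [closure_Ioo hT.ne])
  intro s hs t ht
  have h1 := hall hs
  have h2 := hall ht
  have hadd := intervalIntegral.integral_add_adjacent_intervals (hii 0 h0 s hs) (hii s hs t ht)
  simp only at h1 h2
  linarith

/-! ### Regularity in time and extension of the weak equation to L² test functions -/

theorem MemCSobolev.continuousOn {T : ℝ} {f : ℝ → L2} (h : MemCSobolev 0 T f) :
    ContinuousOn f (Icc 0 T) := by
  intro t ht
  have hlim := (h t ht).2
  rw [ContinuousWithinAt, tendsto_iff_norm_sub_tendsto_zero]
  have h1 : Tendsto (fun r => Real.pi * (sobolevNorm 0 (f r - f t : L2)).toReal) (𝓝[Icc 0 T] t)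
      (𝓝 0) := by
    have := ((ENNReal.tendsto_toReal ENNReal.zero_ne_top).comp hlim).const_mul Real.pi
    simpa using this
  refine h1.congr' ?_
  filter_upwards [hlim.eventually_lt_const ENNReal.zero_lt_top] with r hr
  exact (norm_eq_sobolevNorm_zero hr).symm

/-- The a.e. finiteness is kept alongside because `toReal` sends ∞ to 0, so a bound on the
real-valued norm alone would say nothing at times of infinite norm. -/
theorem MemLpSobolev.memLp_toReal {s T : ℝ} {f : ℝ → L2} (h : MemLpSobolev 2 s T f) :
    (∀ᵐ t ∂timeMeasure T, sobolevNorm s (f t) < ⊤)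
      ∧ MemLp (fun t => (sobolevNorm s (f t)).toReal) 2 (timeMeasure T) := by
  have hm := aemeasurable_sobolevNorm h.1 s
  constructor
  · have h2 := (eLpNorm_lt_top_iff_lintegral_rpow_enorm_lt_top (by norm_num) (by norm_num)).1 h.2
    simp only [enorm_eq_self, ENNReal.toReal_ofNat] at h2
    filter_upwards [ae_lt_top' (hm.pow_const 2) h2.ne] with t ht
    exact ((ENNReal.rpow_lt_top_iff_of_pos (by norm_num)).1 ht)
  · refine ⟨hm.ennreal_toReal.aestronglyMeasurable, lt_of_le_of_lt ?_ h.2⟩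
    refine eLpNorm_mono_enorm fun t => ?_
    rw [enorm_eq_self, Real.enorm_of_nonneg ENNReal.toReal_nonneg]
    exact ENNReal.ofReal_toReal_le

/-- A weak evolution equation `⟨v(t) - v(s), f⟩ = ∫ₛᵗ ⟨g(r), f⟩ dr`, extended from smooth `f` to
all `f ∈ L²`. -/
theorem inner_sub_eq_integral {T : ℝ} {v g : ℝ → L2} {q : ℝ → ℝ}
    (hq : IntegrableOn q (Icc 0 T)) (hg : ∀ᵐ r ∂timeMeasure T, ‖g r‖ ≤ q r)
    (hmeas : ∀ φ, AEStronglyMeasurable (fun r => inner ℝ (g r) (testL2 φ)) (timeMeasure T))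
    (htest : ∀ φ, ∀ s ∈ Icc 0 T, ∀ t ∈ Icc 0 T,
      inner ℝ (v t - v s) (testL2 φ) = ∫ r in s..t, inner ℝ (g r) (testL2 φ)) (f : L2) :
    IntegrableOn (fun r => inner ℝ (g r) f) (Icc 0 T)
      ∧ ∀ s ∈ Icc 0 T, ∀ t ∈ Icc 0 T, inner ℝ (v t - v s) f = ∫ r in s..t, inner ℝ (g r) f := by
  obtain ⟨w, hw, hlim⟩ := mem_closure_iff_seq_limit.1 (denseRange_testL2 f)
  choose φ hφ using hw
  obtain rfl : (fun n => testL2 (φ n)) = w := funext hφ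
  obtain ⟨B, hB⟩ := (Metric.isBounded_range_of_tendsto _ hlim).exists_norm_le
  have hpt : ∀ r, Tendsto (fun n => inner ℝ (g r) (testL2 (φ n))) atTop (𝓝 (inner ℝ (g r) f)) :=
    fun r => tendsto_const_nhds.inner hlim
  -- Only scalar products with g have to be measurable, and these are limits of the measurable ones
  -- with smooth functions.
  have hm : AEStronglyMeasurable (fun r => inner ℝ (g r) f) (timeMeasure T) :=
    aestronglyMeasurable_of_tendsto_ae atTop (fun n => hmeas (φ n)) (Eventually.of_forall hpt)
  have hbound : ∀ f : L2, ∀ᵐ r ∂timeMeasure T, ‖(inner ℝ (g r) f : ℝ)‖ ≤ q r * ‖f‖ := fun f => by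
    filter_upwards [hg] with r hr
    exact (norm_inner_le_norm _ _).trans (mul_le_mul_of_nonneg_right hr (norm_nonneg _))
  refine ⟨(hq.mul_const ‖f‖).mono' hm (hbound f), fun s hs t ht => ?_⟩
  have h1 : Tendsto (fun n => inner ℝ (v t - v s) (testL2 (φ n))) atTop
      (𝓝 (inner ℝ (v t - v s) f)) := tendsto_const_nhds.inner hlim
  refine tendsto_nhds_unique h1 ?_
  simp only [htest _ s hs t ht]
  have hsub : uIoc s t ⊆ Icc 0 T :=
    uIoc_subset_uIcc.trans (ordConnected_Icc.uIcc_subset hs ht)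
  refine intervalIntegral.tendsto_integral_filter_of_dominated_convergence (fun r => q r * B)
    (Eventually.of_forall fun n => (hmeas (φ n)).mono_measure (Measure.restrict_mono hsub le_rfl))
    (Eventually.of_forall fun n => ?_) ?_ (Eventually.of_forall fun r _ => hpt r)
  · filter_upwards [(ae_restrict_iff' measurableSet_Icc).1 hg] with r hr hmem
    exact (norm_inner_le_norm _ _).trans (mul_le_mul (hr (hsub hmem))
      (hB _ (mem_range_self n)) (norm_nonneg _) ((norm_nonneg _).trans (hr (hsub hmem))))
  · exact ((hq.mono_set (ordConnected_Icc.uIcc_subset hs ht)).intervalIntegrable).mul_const B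

/-! ### Evolution of the total excess -/

/-- If `∂ₜv = g` weakly and `⟨truncation M v, g⟩` is controlled by the total excess of `v`, then the
total excess stays zero. -/
theorem totalExcess_nonpos {T M : ℝ} {v g : ℝ → L2} {q : ℝ → ℝ}
    (hv : ContinuousOn v (Icc 0 T)) (hq : IntegrableOn q (Icc 0 T)) (hq0 : ∀ r, 0 ≤ q r)
    (hg : ∀ᵐ r ∂timeMeasure T, ‖g r‖ ≤ q r)
    (hdis : ∀ᵐ r ∂timeMeasure T,
      inner ℝ (truncationL2 M (v r)) (g r) ≤ q r * totalExcess M (v r))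
    (hint : ∀ f : L2, IntegrableOn (fun r => inner ℝ (g r) f) (Icc 0 T)
      ∧ ∀ s ∈ Icc 0 T, ∀ t ∈ Icc 0 T, inner ℝ (v t - v s) f = ∫ r in s..t, inner ℝ (g r) f)
    (h0 : totalExcess M (v 0) ≤ 0) :
    ∀ t ∈ Icc 0 T, totalExcess M (v t) ≤ 0 := by
  intro t ht
  have hT : 0 ≤ T := ht.1.trans ht.2
  have hy : ContinuousOn (fun t => totalExcess M (v t)) (Icc 0 T) :=
    (continuous_totalExcess M).comp_continuousOn hv
  have hii : ∀ s ∈ Icc 0 T, ∀ t ∈ Icc 0 T, IntervalIntegrable q volume s t := fun s hs t ht =>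
    (hq.mono_set (ordConnected_Icc.uIcc_subset hs ht)).intervalIntegrable
  have hzero : (0 : ℝ) ∈ Icc 0 T := ⟨le_rfl, hT⟩
  have hQsub : ∀ s ∈ Icc 0 T, ∀ t ∈ Icc 0 T,
      (∫ r in (0 : ℝ)..t, q r) - ∫ r in (0 : ℝ)..s, q r = ∫ r in s..t, q r := fun s hs t ht =>
    intervalIntegral.integral_interval_sub_left (hii 0 hzero t ht) (hii 0 hzero s hs)
  refine nonpos_of_local_growth (Q := fun t => ∫ r in (0 : ℝ)..t, q r) hy ?_
    intervalIntegral.integral_same ?_ h0 ?_ t ht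
  · have := intervalIntegral.continuousOn_primitive_interval (μ := volume) (f := q) (a := 0) (b := T)
      (by rwa [uIcc_of_le hT])
    rwa [uIcc_of_le hT] at this
  · intro s hs t ht hst
    have h1 := hQsub s hs t ht
    have h2 := intervalIntegral.integral_nonneg (μ := volume) hst fun r _ => hq0 r
    simp only
    linarith
  · intro x hx ε hε
    have hxI : x ∈ Icc 0 T := ⟨hx.1, hx.2.le⟩
    -- Half of ε pays for the variation of the excess. The other half pays for ‖v(t) - v(r)‖, as
    -- both points are within ε/4 of v(x).
    have hnear : ∀ᶠ r in 𝓝[Icc 0 T] x,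
        totalExcess M (v r) < totalExcess M (v x) + ε / 2 ∧ ‖v r - v x‖ < ε / 4 := by
      refine ((hy x hxI).eventually_lt_const (by linarith)).and ?_
      have := (hv x hxI).sub_const (v x) |>.norm
      simp only [sub_self, norm_zero] at this
      exact Tendsto.eventually_lt_const (by simpa using by linarith) this
    obtain ⟨δ, hδ, hball⟩ := Metric.mem_nhdsWithin_iff.1 hnear
    have hmin : x < min (x + δ) T := lt_min (by linarith) hx.2
    filter_upwards [Ioo_mem_nhdsGT hmin] with t htx
    have htδ : t < x + δ := htx.2.trans_le (min_le_left _ _)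
    have htT : t < T := htx.2.trans_le (min_le_right _ _)
    have htI : t ∈ Icc 0 T := ⟨hx.1.trans htx.1.le, htT.le⟩
    have hloc : ∀ r ∈ Icc x t,
        totalExcess M (v r) < totalExcess M (v x) + ε / 2 ∧ ‖v r - v x‖ < ε / 4 := fun r hr => by
      refine hball ⟨?_, hx.1.trans hr.1, hr.2.trans htT.le⟩
      rw [Metric.mem_ball, Real.dist_eq, abs_lt]
      exact ⟨by linarith [hr.1], by linarith [hr.2]⟩
    have hsubset : Icc x t ⊆ Icc 0 T := Icc_subset_Icc hx.1 htT.le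
    -- The truncation is frozen at the right endpoint t, giving a fixed element of L² to test with.
    -- Under the integral it is exchanged for the truncation at time r, where the dissipation bound
    -- applies.
    obtain ⟨hi, heq⟩ := hint (truncationL2 M (v t))
    have hle : ∫ r in x..t, inner ℝ (g r) (truncationL2 M (v t))
        ≤ ∫ r in x..t, (totalExcess M (v x) + ε) * q r := by
      refine intervalIntegral.integral_mono_ae_restrict htx.1.le
        (hi.mono_set (by rwa [uIcc_of_le htx.1.le])).intervalIntegrable
        ((hii x hxI t htI).const_mul _) ?_
      have hae : ∀ᵐ r ∂(volume.restrict (Icc x t)), ‖g r‖ ≤ q r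
          ∧ inner ℝ (truncationL2 M (v r)) (g r) ≤ q r * totalExcess M (v r) :=
        ae_restrict_of_ae_restrict_of_subset hsubset (hg.and hdis)
      filter_upwards [hae, ae_restrict_mem measurableSet_Icc] with r hr hrI
      have h1 := hloc r hrI
      have h2 := hloc t (right_mem_Icc.2 htx.1.le)
      have h3 : inner ℝ (g r) (truncationL2 M (v t)) = inner ℝ (truncationL2 M (v r)) (g r)
          + inner ℝ (g r) (truncationL2 M (v t) - truncationL2 M (v r)) := by
        rw [inner_sub_right, real_inner_comm (g r) (truncationL2 M (v r))]
        ring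
      have h4 : inner ℝ (g r) (truncationL2 M (v t) - truncationL2 M (v r)) ≤ q r * (ε / 2) := by
        refine (real_inner_le_norm _ _).trans (mul_le_mul hr.1 ?_ (norm_nonneg _) (hq0 r))
        refine (norm_truncationL2_sub_le M _ _).trans ?_
        have h5 : v t - v r = (v t - v x) - (v r - v x) := by abel
        rw [h5]
        linarith [norm_sub_le (v t - v x) (v r - v x), h1.2, h2.2]
      have h6 := mul_le_mul_of_nonneg_left h1.1.le (hq0 r)
      rw [h3]
      linarith [hr.2]
    rw [hQsub x hxI t htI, ← intervalIntegral.integral_const_mul]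
    refine (totalExcess_sub_le M (v t) (v x)).trans (le_trans (le_of_eq ?_) hle)
    rw [real_inner_comm, heq x hxI t htI]

theorem ae_abs_le_of_totalExcess_nonpos {M : ℝ} (hM : 0 ≤ M) {f : L2}
    (h : totalExcess M f ≤ 0) : ∀ᵐ x, |f x| ≤ M := by
  have h1 := (integral_eq_zero_iff_of_nonneg (fun x => excess_nonneg M _)
    (integrable_excess M f)).1 (le_antisymm h (totalExcess_nonneg M f))
  filter_upwards [h1] with x hx
  exact abs_le_of_excess_nonpos hM hx.le

theorem totalExcess_eq_zero {M : ℝ} {f : L2} (h : ∀ᵐ x, |f x| ≤ M) : totalExcess M f = 0 :=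
  integral_eq_zero_of_ae (h.mono fun _ hx => excess_eq_zero hx)

/-- At almost every time the equation represents ∂ₜu₁ by an L² function satisfying the dissipation
bound, which places the solution under the abstract result on weak evolutions. -/
theorem IsStrongSolution.totalExcess_nonpos {ν lam T M : ℝ} (hν : 0 < ν) (hT : 0 < T)
    {uin : Fin 2 → L2} {u : Fin 2 → ℝ → L2} (hu : IsStrongSolution ν lam T uin u)
    (h0 : totalExcess M (uin 0) ≤ 0) : ∀ t ∈ Icc 0 T, totalExcess M (u 0 t) ≤ 0 := by
  obtain ⟨du, hdu, heq, -⟩ := hu.equation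
  have hcont : ContinuousOn (u 0) (Icc 0 T) :=
    (hu.mem_C_Hs 0 0 ⟨le_rfl, zero_lt_one⟩).continuousOn
  obtain ⟨hfin0, hmem0⟩ := hu.mem_L2_H2.memLp_toReal
  obtain ⟨hfin1, hmem1⟩ := hu.mem_L2_H3.memLp_toReal
  set N : ℝ → ℝ := fun t => (sobolevNorm 2 (u 0 t)).toReal + (sobolevNorm 3 (u 1 t)).toReal with hN
  have hN0 : ∀ t, 0 ≤ N t := fun t => add_nonneg ENNReal.toReal_nonneg ENNReal.toReal_nonneg
  have hNmem : MemLp N 2 (timeMeasure T) := hmem0.add hmem1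
  set C := embeddingConstant with hC
  have hC0 : 0 ≤ C := embeddingConstant_nonneg
  -- One integrable function dominating both the norm bound 4π(ν + CN)N of the right-hand side and
  -- the growth rate (CN)²/ν. It is quadratic in N, which is square integrable in time.
  set q : ℝ → ℝ := fun t =>
    4 * Real.pi * ν * N t + (4 * Real.pi * C + C ^ 2 / ν) * N t ^ 2 with hqdef
  have hq0 : ∀ t, 0 ≤ q t := fun t => by
    have := hN0 t
    positivity
  have hq : IntegrableOn q (Icc 0 T) :=
    ((hNmem.integrable (by norm_num)).const_mul _).add (hNmem.integrable_sq.const_mul _)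
  have hex : ∀ᵐ t ∂timeMeasure T, ∃ g : L2, ‖g‖ ≤ q t
      ∧ inner ℝ (truncationL2 M (u 0 t)) g ≤ q t * totalExcess M (u 0 t)
      ∧ ∀ φ : testFunctions, ν * gradPairing (u 0 t) φ
        + transportPairing (fun j => u j t) (u 0 t) φ = -inner ℝ g (testL2 φ) := by
    filter_upwards [hfin0, hfin1] with t ht0 ht1
    have hle0 : (sobolevNorm 2 (u 0 t)).toReal ≤ N t :=
      le_add_of_nonneg_right ENNReal.toReal_nonneg
    have hle1 : (sobolevNorm 3 (u 1 t)).toReal ≤ N t :=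
      le_add_of_nonneg_left ENNReal.toReal_nonneg
    have hsup : ∀ j, ∀ᵐ x, |u j t x| ≤ C * N t := by
      rw [Fin.forall_fin_two]
      constructor
      · filter_upwards [ae_abs_le_sobolevNorm le_rfl ht0] with x hx
        exact hx.trans (mul_le_mul_of_nonneg_left hle0 hC0)
      · filter_upwards [ae_abs_le_sobolevNorm (by norm_num) ht1] with x hx
        exact hx.trans (mul_le_mul_of_nonneg_left hle1 hC0)
    obtain ⟨g, hg, hgn, hgp⟩ := exists_rhs hν (mul_nonneg hC0 (hN0 t)) ht0 hsup
    have hpi := Real.pi_pos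
    have hNt := hN0 t
    refine ⟨g, hgn.trans ?_, (inner_truncationL2_rhs_le hν M ht0 hsup hg).trans ?_, hgp⟩
    · calc 4 * Real.pi * (ν + C * N t) * (sobolevNorm 2 (u 0 t)).toReal
          ≤ 4 * Real.pi * (ν + C * N t) * N t := by gcongr
        _ ≤ 4 * Real.pi * (ν + C * N t) * N t + C ^ 2 / ν * N t ^ 2 :=
          le_add_of_nonneg_right (by positivity)
        _ = q t := by rw [hqdef]; ring
    · refine mul_le_mul_of_nonneg_right ?_ (totalExcess_nonneg M _)
      calc (C * N t) ^ 2 / ν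
          ≤ (C * N t) ^ 2 / ν + (4 * Real.pi * ν * N t + 4 * Real.pi * C * N t ^ 2) :=
            le_add_of_nonneg_right (by positivity)
        _ = q t := by rw [hqdef]; ring
  have hne : (ae (timeMeasure T)).NeBot := by
    rw [ae_neBot, Ne, Measure.restrict_eq_zero, Real.volume_Icc, sub_zero, ENNReal.ofReal_eq_zero]
    exact not_le.2 hT
  -- The selection g is not known to be measurable. Its scalar products with smooth functions are,
  -- because they agree a.e. with -⟨∂ₜu₁, φ⟩ up to sign conventions of the weak equation.
  obtain ⟨g, hg⟩ := hex.choice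
  have hdug : ∀ φ : testFunctions,
      (fun t => du 0 t φ) =ᵐ[timeMeasure T] fun t => inner ℝ (g t) (testL2 φ) := fun φ => by
    filter_upwards [heq φ, hg] with t h1 h2
    linarith [h2.2.2 φ]
  have hgn : ∀ᵐ t ∂timeMeasure T, ‖g t‖ ≤ q t := hg.mono fun t ht => ht.1
  have hmeas : ∀ φ, AEStronglyMeasurable (fun r => inner ℝ (g r) (testL2 φ)) (timeMeasure T) :=
    fun φ => ((hdu 0).2.1 φ).congr (hdug φ)
  have htest : ∀ φ, ∀ s ∈ Icc 0 T, ∀ t ∈ Icc 0 T,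
      inner ℝ (u 0 t - u 0 s) (testL2 φ) = ∫ r in s..t, inner ℝ (g r) (testL2 φ) := by
    intro φ s hs t ht
    rw [inner_sub_left]
    refine sub_eq_integral_of_weak_deriv hT (h := fun t => inner ℝ (u 0 t) (testL2 φ))
      (hcont.inner continuousOn_const) ?_ (fun ψ h1 h2 h3 => ?_) s hs t ht
    · refine (hq.mul_const ‖testL2 φ‖).mono' (hmeas φ) ?_
      filter_upwards [hgn] with r hr
      exact (norm_inner_le_norm _ _).trans (mul_le_mul_of_nonneg_right hr (norm_nonneg _))
    · have h4 := (hdu 0).1 φ ψ h1 h2 h3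
      simp only [pairing_test] at h4
      rw [h4]
      congr 1
      refine integral_congr_ae ?_
      filter_upwards [hdug φ] with r hr
      rw [hr]
  refine RKSE.totalExcess_nonpos hcont hq hq0 hgn (hg.mono fun t ht => ht.2.1)
    (inner_sub_eq_integral hq hgn hmeas htest) ?_
  rwa [hu.initial 0]

end RKSE

end

theorem proposition4p2 (ν lam T : ℝ) (hν : 0 < ν) (hlam : 0 < lam) (hT : 0 < T)
    (uin : Fin 2 → RKSE.L2) (u : Fin 2 → ℝ → RKSE.L2)
    (hu : RKSE.IsStrongSolution ν lam T uin u) :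
    ⨆ t ∈ Set.Icc 0 T, eLpNorm (u 0 t) ⊤ volume ≤ eLpNorm (uin 0) ⊤ volume := by
  refine iSup₂_le fun t ht => ?_
  -- With the infinite case set aside, the real number M obtained by `toReal` is a genuine bound for
  -- the initial value.
  by_cases htop : eLpNorm (uin 0) ⊤ volume = ⊤
  · rw [htop]
    exact le_top
  have hM : 0 ≤ (eLpNorm (uin 0) ⊤ volume).toReal := ENNReal.toReal_nonneg
  have hinit : ∀ᵐ x, |uin 0 x| ≤ (eLpNorm (uin 0) ⊤ volume).toReal := by
    rw [eLpNorm_exponent_top] at htop ⊢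
    filter_upwards [ae_le_eLpNormEssSup (f := uin 0) (μ := volume)] with x hx
    rw [← Real.norm_eq_abs, ← toReal_enorm]
    exact ENNReal.toReal_mono htop hx
  have hfinal := RKSE.ae_abs_le_of_totalExcess_nonpos hM
    (hu.totalExcess_nonpos hν hT (RKSE.totalExcess_eq_zero hinit).le t ht)
  rw [eLpNorm_exponent_top]
  refine (eLpNormEssSup_le_of_ae_bound hfinal).trans ?_
  rw [ENNReal.ofReal_toReal htop]
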